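/- **Theorem 4.2.** Let $N\ge 0$ and $\omega=(\omega_1,\dots,\omega_N)\in\mathbb R^N$. For $0\le a\le b\le N$ put $\omega_{ab}=\omega_{a+1}\omega_{a+2}\cdots\omega_b$ (so $\omega_{aa}=1$). Let $e_{ab}$ ($0\le a,b\le N$) be the elementary $(N+1)\times(N+1)$ matrices, and let $u_\omega(N+1)$ be the real Lie algebra of complex matrices generated by $$J_{ab}=-\omega_{ab}e_{ab}+e_{ba},\quad M_{ab}=i(\omega_{ab}e_{ab}+e_{ba})\quad(0\le a<b\le N),\quad B_l=i(e_{l-1,l-1}-e_{ll})\quad(1\le l\le N),\quad I=i\sum_{a=0}^N e_{aa};$$ these $(N+1)^2$ matrices are a basis of it. A central extension of $u_\omega(N+1)$ is a short exact sequence of real Lie algebras $0\to\mathbb R\to E\to u_\omega(N+1)\to0$ in which the image $\Xi$ of $1\in\mathbb R$ is central in $E$. Two are equivalent if there is an isomorphism of the middle algebras compatible with the identities of $\mathbb R$ and of $u_\omega(N+1)$; an extension is trivial if it is split by a Lie algebra homomorphism $u_\omega(N+1)\to E$. Given real numbers $\alpha_k$, $\gamma_k$ ($1\le k\le N$) and $\beta_{kl}$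 ($1\le k<l\le N$), say that $E$ *has coefficients* $(\alpha,\beta,\gamma)$ if the generators $J_{ab},M_{ab},B_l,I$ have lifts to $E$, denoted by the same letters, such that, for $a<b<c$, $$\begin{array}{lll} [J_{ab},J_{ac}]=\omega_{ab}J_{bc},&[J_{ab},J_{bc}]=-J_{ac},&[J_{ac},J_{bc}]=\omega_{bc}J_{ab},\\ [M_{ab},M_{ac}]=\omega_{ab}J_{bc},&[M_{ab},M_{bc}]=J_{ac},&[M_{ac},M_{bc}]=\omega_{bc}J_{ab},\\ [J_{ab},M_{ac}]=\omega_{ab}M_{bc},&[J_{ab},M_{bc}]=-M_{ac},&[J_{ac},M_{bc}]=-\omega_{bc}M_{ab},\\ [M_{ab},J_{ac}]=-\omega_{ab}M_{bc},&[M_{ab},J_{bc}]=-M_{ac},&[M_{ac},J_{bc}]=\omega_{bc}M_{ab}; \end{array}$$ $[J_{ab},J_{de}]=[M_{ab},M_{de}]=[J_{ab},M_{de}]=0$ whenever $a<b$, $d<e$ and $a,b,d,e$ are distinct; and, for $a<b$ and all $l$, $$[J_{ab},B_l]=(\delta_{a,l-1}-\delta_{b,l-1}+\delta_{bl}-\delta_{al})M_{ab},\qquad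 [M_{ab},B_l]=-(\delta_{a,l-1}-\delta_{b,l-1}+\delta_{bl}-\delta_{al})J_{ab},$$ $$[J_{ab},M_{ab}]=-2\omega_{ab}\sum_{s=a+1}^bB_s+\sum_{s=a+1}^b\omega_{a,s-1}\,\omega_{sb}\,\alpha_s\,\Xi,\qquad [B_k,B_l]=\beta_{kl}\,\Xi\ \ (k<l),$$ $$[J_{ab},I]=0,\qquad[M_{ab},I]=0,\qquad[B_k,I]=\gamma_k\,\Xi .$$ Then: 1. Every central extension of $u_\omega(N+1)$ has coefficients $(\alpha,\beta,\gamma)$ for some $\alpha,\beta,\gamma$. 2. Whenever a central extension has coefficients $(\alpha,\beta,\gamma)$, then $\omega_k\beta_{kl}=\omega_l\beta_{kl}=0$ for all $k<l$ and $\omega_k\gamma_k=0$ for all $k$. Conversely, for all real $\alpha,\beta,\gamma$ with these properties there is a central extension with coefficients $(\alpha,\beta,\gamma)$. 3. Two central extensions with coefficients $(\alpha,\beta,\gamma)$ and $(\alpha',\beta',\gamma')$ are equivalent if and only if $\beta=\beta'$, $\gamma=\gamma'$, and $\alpha_k=\alpha'_k$ for every $k$ with $\omega_k=0$. 4. A central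 extension with coefficients $(\alpha,\beta,\gamma)$ is trivial if and only if $\beta=0$, $\gamma=0$, and $\alpha_k=0$ for every $k$ with $\omega_k=0$. In particular it is non-trivial as soon as some $\gamma_k\neq0$ (or some $\beta_{kl}\ne0$, or some $\alpha_k\neq 0$ with $\omega_k=0$), while an $\alpha_k$ with $\omega_k\ne0$ contributes only a trivial extension. -/

import Mathlib

attribute [local instance 100] LieRing.ofAssociativeRing

/-- Labels of the generators of `u_ω(N+1)`: `J_ab`, `M_ab` for `0 ≤ a < b ≤ N`, then the `N`
generators `B_l`, and `I`.  The index `l : Fin N` is the zero-based form of `1, …, N`: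
the label `B l` stands for the generator usually written `B_{l+1}`. -/
inductive CKGen (N : ℕ) : Type
  | J (a b : Fin (N + 1)) (h : a < b) : CKGen N
  | M (a b : Fin (N + 1)) (h : a < b) : CKGen N
  | B (l : Fin N) : CKGen N
  | I : CKGen N

/-- The indices `s` with `a ≤ s < b`; in the one-based numbering of the constants `ω_1, …, ω_N`
these are `a + 1, …, b`. -/
def ckBetween {N : ℕ} (a b : Fin (N + 1)) : Finset (Fin N) :=
  Finset.univ.filter fun s => a ≤ s.castSucc ∧ s.castSucc < b

/-- The two-index constant `ω_ab = ω_{a+1} ⋯ ω_b`, where `ω k` is the one-based `ω_{k+1}`;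
in particular it is `1` for `a = b`. -/
def ckOmega {N : ℕ} (ω : Fin N → ℝ) (a b : Fin (N + 1)) : ℝ :=
  ∏ k ∈ ckBetween a b, ω k

/-- The number `δ_{a,l-1} - δ_{b,l-1} + δ_{b,l} - δ_{a,l}` for the one-based index `l`
(that is, `l.castSucc` stands for `l - 1` and `l.succ` for `l`). -/
def ckDelta {N : ℕ} (a b : Fin (N + 1)) (l : Fin N) : ℝ :=
  (if a = l.castSucc then 1 else 0) - (if b = l.castSucc then 1 else 0)
    + (if b = l.succ then 1 else 0) - (if a = l.succ then 1 else 0)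

/-- The matrices `J_ab = -ω_ab e_ab + e_ba`, `M_ab = i (ω_ab e_ab + e_ba)`,
`B_l = i (e_{l-1,l-1} - e_{l,l})` and `I = i ∑ e_aa`. -/
noncomputable def ckMatrix {N : ℕ} (ω : Fin N → ℝ) :
    CKGen N → Matrix (Fin (N + 1)) (Fin (N + 1)) ℂ
  | .J a b _ => -Matrix.single a b (ckOmega ω a b : ℂ) + Matrix.single b a 1
  | .M a b _ => Complex.I • (Matrix.single a b (ckOmega ω a b : ℂ) + Matrix.single b a 1)
  | .B l =>
    Complex.I • (Matrix.single l.castSucc l.castSucc 1 - Matrix.single l.succ l.succ 1)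
  | .I => Complex.I • 1

/-- The unitary Cayley–Klein algebra `u_ω(N+1)`: the real Lie algebra of complex matrices
generated by the `J_ab`, `M_ab`, `B_l` and `I`. -/
noncomputable def uCK {N : ℕ} (ω : Fin N → ℝ) :
    LieSubalgebra ℝ (Matrix (Fin (N + 1)) (Fin (N + 1)) ℂ) :=
  LieSubalgebra.lieSpan ℝ _ (Set.range (ckMatrix ω))

/-- The generators as elements of `u_ω(N+1)`. -/
noncomputable def ckGen {N : ℕ} (ω : Fin N → ℝ) (g : CKGen N) : uCK ω :=
  ⟨ckMatrix ω g, LieSubalgebra.subset_lieSpan (Set.mem_range_self g)⟩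

/-- The commutation relations of an extension of `u_ω(N+1)` with coefficients `α_k`, `β_kl`
(only the values with `k < l` are used) and `γ_k`, for elements `X g` and `Ξ` of a real Lie
algebra.  For `Ξ = 0` these are the commutation relations of `u_ω(N+1)` itself. -/
structure CKRelations {N : ℕ} (ω : Fin N → ℝ) {E : Type*} [LieRing E] [LieAlgebra ℝ E]
    (X : CKGen N → E) (Ξ : E) (α : Fin N → ℝ) (β : Fin N → Fin N → ℝ) (γ : Fin N → ℝ) :
    Prop where
  JJ_ab_ac : ∀ a b c (hab : a < b) (hbc : b < c),
    ⁅X (.J a b hab), X (.J a c (hab.trans hbc))⁆ = ckOmega ω a b • X (.J b c hbc)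
  JJ_ab_bc : ∀ a b c (hab : a < b) (hbc : b < c),
    ⁅X (.J a b hab), X (.J b c hbc)⁆ = -X (.J a c (hab.trans hbc))
  JJ_ac_bc : ∀ a b c (hab : a < b) (hbc : b < c),
    ⁅X (.J a c (hab.trans hbc)), X (.J b c hbc)⁆ = ckOmega ω b c • X (.J a b hab)
  MM_ab_ac : ∀ a b c (hab : a < b) (hbc : b < c),
    ⁅X (.M a b hab), X (.M a c (hab.trans hbc))⁆ = ckOmega ω a b • X (.J b c hbc)
  MM_ab_bc : ∀ a b c (hab : a < b) (hbc : b < c),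
    ⁅X (.M a b hab), X (.M b c hbc)⁆ = X (.J a c (hab.trans hbc))
  MM_ac_bc : ∀ a b c (hab : a < b) (hbc : b < c),
    ⁅X (.M a c (hab.trans hbc)), X (.M b c hbc)⁆ = ckOmega ω b c • X (.J a b hab)
  JM_ab_ac : ∀ a b c (hab : a < b) (hbc : b < c),
    ⁅X (.J a b hab), X (.M a c (hab.trans hbc))⁆ = ckOmega ω a b • X (.M b c hbc)
  JM_ab_bc : ∀ a b c (hab : a < b) (hbc : b < c),
    ⁅X (.J a b hab), X (.M b c hbc)⁆ = -X (.M a c (hab.trans hbc))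
  JM_ac_bc : ∀ a b c (hab : a < b) (hbc : b < c),
    ⁅X (.J a c (hab.trans hbc)), X (.M b c hbc)⁆ = -(ckOmega ω b c • X (.M a b hab))
  MJ_ab_ac : ∀ a b c (hab : a < b) (hbc : b < c),
    ⁅X (.M a b hab), X (.J a c (hab.trans hbc))⁆ = -(ckOmega ω a b • X (.M b c hbc))
  MJ_ab_bc : ∀ a b c (hab : a < b) (hbc : b < c),
    ⁅X (.M a b hab), X (.J b c hbc)⁆ = -X (.M a c (hab.trans hbc))
  MJ_ac_bc : ∀ a b c (hab : a < b) (hbc : b < c),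
    ⁅X (.M a c (hab.trans hbc)), X (.J b c hbc)⁆ = ckOmega ω b c • X (.M a b hab)
  JJ_disjoint : ∀ a b d e (hab : a < b) (hde : d < e), a ≠ d → a ≠ e → b ≠ d → b ≠ e →
    ⁅X (.J a b hab), X (.J d e hde)⁆ = 0
  MM_disjoint : ∀ a b d e (hab : a < b) (hde : d < e), a ≠ d → a ≠ e → b ≠ d → b ≠ e →
    ⁅X (.M a b hab), X (.M d e hde)⁆ = 0
  JM_disjoint : ∀ a b d e (hab : a < b) (hde : d < e), a ≠ d → a ≠ e → b ≠ d → b ≠ e →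
    ⁅X (.J a b hab), X (.M d e hde)⁆ = 0
  JB : ∀ a b (hab : a < b) l, ⁅X (.J a b hab), X (.B l)⁆ = ckDelta a b l • X (.M a b hab)
  MB : ∀ a b (hab : a < b) l, ⁅X (.M a b hab), X (.B l)⁆ = -(ckDelta a b l • X (.J a b hab))
  /-- `[J_ab, M_ab] = -2 ω_ab ∑ B_s + ∑ ω_{a,s-1} ω_{s,b} α_s Ξ`, sums over one-based
  `s = a+1, …, b`. -/
  JM_ab_ab : ∀ a b (hab : a < b), ⁅X (.J a b hab), X (.M a b hab)⁆ =
    (-2 * ckOmega ω a b) • ∑ s ∈ ckBetween a b, X (.B s)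
      + (∑ s ∈ ckBetween a b, ckOmega ω a s.castSucc * ckOmega ω s.succ b * α s) • Ξ
  BB : ∀ k l, k < l → ⁅X (.B k), X (.B l)⁆ = β k l • Ξ
  JI : ∀ a b (hab : a < b), ⁅X (.J a b hab), X .I⁆ = 0
  MI : ∀ a b (hab : a < b), ⁅X (.M a b hab), X .I⁆ = 0
  BI : ∀ k, ⁅X (.B k), X .I⁆ = γ k • Ξ

theorem ckOmega_self {N : ℕ} (ω : Fin N → ℝ) (a : Fin (N + 1)) : ckOmega ω a a = 1 := by
  have : ckBetween a a = (∅ : Finset (Fin N)) := by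
    ext s; simp [ckBetween]
  simp [ckOmega, this]

theorem ckOmega_mul {N : ℕ} (ω : Fin N → ℝ) {a b c : Fin (N + 1)} (hab : a ≤ b) (hbc : b ≤ c) :
    ckOmega ω a b * ckOmega ω b c = ckOmega ω a c := by
  unfold ckOmega
  rw [← Finset.prod_union]
  · congr 1
    ext s
    simp only [ckBetween, Finset.mem_union, Finset.mem_filter, Finset.mem_univ, true_and]
    constructor
    · rintro (h | h)
      · exact ⟨h.1, h.2.trans_le hbc⟩
      · exact ⟨hab.trans h.1, h.2⟩
    · intro h
      rcases lt_or_ge s.castSucc b with h' | h'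
      · exact Or.inl ⟨h.1, h'⟩
      · exact Or.inr ⟨h', h.2⟩
  · rw [Finset.disjoint_left]
    intro s h h'
    simp only [ckBetween, Finset.mem_filter, Finset.mem_univ, true_and] at h h'
    exact absurd h.2 (not_lt.mpr h'.1)

theorem ckBetween_telescope {N : ℕ} {A : Type*} [AddCommGroup A] (f : Fin (N + 1) → A)
    (a b : Fin (N + 1)) (hab : a ≤ b) :
    ∑ s ∈ ckBetween a b, (f s.castSucc - f s.succ) = f a - f b := by
  induction b using Fin.induction with
  | zero =>
    have h : a = 0 := le_antisymm hab (Fin.zero_le a)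
    subst h
    have : ckBetween (0 : Fin (N + 1)) 0 = (∅ : Finset (Fin N)) := by
      ext s; simp [ckBetween]
    simp [this]
  | succ i ih =>
    rcases hab.eq_or_lt with h | h
    · subst h
      have : ckBetween i.succ i.succ = (∅ : Finset (Fin N)) := by
        ext s; simp [ckBetween]
      simp [this]
    · have h' : a ≤ i.castSucc := by
        rw [Fin.le_def]; rw [Fin.lt_def] at h; simp at h ⊢; omega
      have : ckBetween a i.succ = insert i (ckBetween a i.castSucc) := by
        ext s
        simp only [ckBetween, Finset.mem_insert, Finset.mem_filter, Finset.mem_univ, true_and,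
          Fin.le_def, Fin.lt_def, Fin.ext_iff, Fin.val_castSucc, Fin.val_succ] at h' ⊢
        omega
      rw [this, Finset.sum_insert (by simp [ckBetween]), ih h']
      abel

theorem ck_single_mul {N : ℕ} (i j k l : Fin (N + 1)) :
    Matrix.single i j (1 : ℂ) * Matrix.single k l 1 =
      if j = k then Matrix.single i l 1 else 0 := by
  split_ifs with h
  · subst h; simp
  · simp [Matrix.single_mul_single_of_ne, h]

theorem ckMatrix_J {N : ℕ} (ω : Fin N → ℝ) (a b : Fin (N + 1)) (h : a < b) :
    ckMatrix ω (.J a b h) =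
      -((ckOmega ω a b : ℂ) • Matrix.single a b 1) + Matrix.single b a 1 := by
  simp [ckMatrix, Matrix.smul_single]

theorem ckMatrix_M {N : ℕ} (ω : Fin N → ℝ) (a b : Fin (N + 1)) (h : a < b) :
    ckMatrix ω (.M a b h) =
      Complex.I • ((ckOmega ω a b : ℂ) • Matrix.single a b 1 + Matrix.single b a 1) := by
  simp [ckMatrix, Matrix.smul_single]

theorem ck_single_mul_diag {N : ℕ} (i j k : Fin (N + 1)) :
    Matrix.single i j (1 : ℂ) * Matrix.single k k 1 =
      (if j = k then 1 else 0 : ℂ) • Matrix.single i j 1 := by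
  rw [ck_single_mul]; split_ifs with h
  · simp [h]
  · simp

theorem ck_diag_mul_single {N : ℕ} (i j k : Fin (N + 1)) :
    Matrix.single k k (1 : ℂ) * Matrix.single i j 1 =
      (if i = k then 1 else 0 : ℂ) • Matrix.single i j 1 := by
  rw [ck_single_mul]; split_ifs with h h' h'
  · simp [h]
  · exact absurd h.symm h'
  · exact absurd h'.symm h
  · simp

set_option linter.unusedSimpArgs false in
/-- The matrices satisfy the commutation relations. -/
theorem ckMatrix_relations {N : ℕ} (ω : Fin N → ℝ) :
    CKRelations ω (ckMatrix ω) 0 0 0 0 := by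
  constructor
  case JI | MI | BI => intros; simp [ckMatrix, Ring.lie_def]
  case BB =>
    intro k l hkl
    have hc : ∀ i j : Fin (N + 1), Commute (Matrix.single i i (1 : ℂ)) (Matrix.single j j 1) := by
      intro i j
      rw [Commute, SemiconjBy, ck_single_mul, ck_single_mul]
      split_ifs with h h' h'
      · rw [h]
      · exact absurd h.symm h'
      · exact absurd h'.symm h
      · rfl
    rw [smul_zero, ← commute_iff_lie_eq]
    exact (((hc _ _).sub_right (hc _ _)).sub_left
      ((hc _ _).sub_right (hc _ _))).smul_left _ |>.smul_right _
  case JB | MB =>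
    intro a b hab l
    have hd : ((ckDelta a b l : ℝ) : ℂ) = (if a = l.castSucc then 1 else 0)
        - (if b = l.castSucc then 1 else 0) + (if b = l.succ then 1 else 0)
        - (if a = l.succ then 1 else 0) := by
      simp only [ckDelta, Complex.ofReal_sub, Complex.ofReal_add, apply_ite Complex.ofReal,
        Complex.ofReal_one, Complex.ofReal_zero]
    simp only [ckMatrix_J, ckMatrix_M, Ring.lie_def, ← Complex.coe_smul, hd]
    simp only [ckMatrix, mul_add, add_mul, mul_neg, neg_mul, mul_sub, sub_mul, smul_mul_assoc,
      mul_smul_comm, ck_single_mul_diag, ck_diag_mul_single]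
    match_scalars <;> ring_nf <;> simp only [Complex.I_sq] <;> ring
  case JM_ab_ab =>
    intro a b hab
    have h1 := hab.ne
    have h1' := h1.symm
    have ht := ckBetween_telescope
      (fun c => Complex.I • Matrix.single c c (1 : ℂ)) a b hab.le
    have hB : ∀ s : Fin N, ckMatrix ω (.B s) = Complex.I • Matrix.single s.castSucc s.castSucc 1
        - Complex.I • Matrix.single s.succ s.succ 1 := fun s => by simp only [ckMatrix, smul_sub]
    simp only [hB, ht, smul_zero, add_zero]
    simp only [Ring.lie_def, ckMatrix_J, ckMatrix_M, mul_add, add_mul, mul_neg, neg_mul,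
      smul_mul_assoc, mul_smul_comm, ck_single_mul, ← Complex.coe_smul, h1, h1', if_true, if_false,
      smul_zero, add_zero, zero_add, neg_zero, Complex.ofReal_mul, Complex.ofReal_neg,
      Complex.ofReal_ofNat]
    match_scalars <;> ring
  case JJ_disjoint | MM_disjoint | JM_disjoint =>
    intro a b d e hab hde h1 h2 h3 h4
    simp only [Ring.lie_def, ckMatrix_J, ckMatrix_M, mul_add, add_mul, mul_neg, neg_mul,
      smul_mul_assoc, mul_smul_comm, ck_single_mul, h1, h2, h3, h4, h1.symm, h2.symm, h3.symm,
      h4.symm, if_false, smul_zero, add_zero, neg_zero, sub_zero]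
  all_goals
    intro a b c hab hbc
    have h1 := hab.ne
    have h2 := hbc.ne
    have h3 := (hab.trans hbc).ne
    simp only [Ring.lie_def, ckMatrix_J, ckMatrix_M, mul_add, add_mul, mul_neg, neg_mul,
      smul_mul_assoc, mul_smul_comm, ck_single_mul, ← Complex.coe_smul, ← ckOmega_mul ω hab.le hbc.le,
      Complex.ofReal_mul, h1, h2, h3, h1.symm, h2.symm, h3.symm, if_true, if_false, smul_zero,
      add_zero, zero_add, neg_zero]
    match_scalars <;> ring_nf <;> simp only [Complex.I_sq] <;> ring

/-- The generators of `u_ω(N+1)` satisfy its commutation relations. -/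
theorem ckGen_relations {N : ℕ} (ω : Fin N → ℝ) :
    CKRelations ω (ckGen ω) 0 0 0 0 := by
  have h := ckMatrix_relations ω
  exact {
    JJ_ab_ac := fun a b c hab hbc => Subtype.ext (h.JJ_ab_ac a b c hab hbc)
    JJ_ab_bc := fun a b c hab hbc => Subtype.ext (h.JJ_ab_bc a b c hab hbc)
    JJ_ac_bc := fun a b c hab hbc => Subtype.ext (h.JJ_ac_bc a b c hab hbc)
    MM_ab_ac := fun a b c hab hbc => Subtype.ext (h.MM_ab_ac a b c hab hbc)
    MM_ab_bc := fun a b c hab hbc => Subtype.ext (h.MM_ab_bc a b c hab hbc)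
    MM_ac_bc := fun a b c hab hbc => Subtype.ext (h.MM_ac_bc a b c hab hbc)
    JM_ab_ac := fun a b c hab hbc => Subtype.ext (h.JM_ab_ac a b c hab hbc)
    JM_ab_bc := fun a b c hab hbc => Subtype.ext (h.JM_ab_bc a b c hab hbc)
    JM_ac_bc := fun a b c hab hbc => Subtype.ext (h.JM_ac_bc a b c hab hbc)
    MJ_ab_ac := fun a b c hab hbc => Subtype.ext (h.MJ_ab_ac a b c hab hbc)
    MJ_ab_bc := fun a b c hab hbc => Subtype.ext (h.MJ_ab_bc a b c hab hbc)
    MJ_ac_bc := fun a b c hab hbc => Subtype.ext (h.MJ_ac_bc a b c hab hbc)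
    JJ_disjoint := fun a b d e hab hde h1 h2 h3 h4 =>
      Subtype.ext (h.JJ_disjoint a b d e hab hde h1 h2 h3 h4)
    MM_disjoint := fun a b d e hab hde h1 h2 h3 h4 =>
      Subtype.ext (h.MM_disjoint a b d e hab hde h1 h2 h3 h4)
    JM_disjoint := fun a b d e hab hde h1 h2 h3 h4 =>
      Subtype.ext (h.JM_disjoint a b d e hab hde h1 h2 h3 h4)
    JB := fun a b hab l => Subtype.ext (h.JB a b hab l)
    MB := fun a b hab l => Subtype.ext (h.MB a b hab l)
    JM_ab_ab := fun a b hab => Subtype.ext (by simpa [ckGen] using h.JM_ab_ab a b hab)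
    BB := fun k l hkl => Subtype.ext (h.BB k l hkl)
    JI := fun a b hab => Subtype.ext (h.JI a b hab)
    MI := fun a b hab => Subtype.ext (h.MI a b hab)
    BI := fun k => Subtype.ext (h.BI k) }

theorem ck_entry_mul {N : ℕ} (ω : Fin N → ℝ) {X Y : Matrix (Fin (N + 1)) (Fin (N + 1)) ℂ}
    (hX : ∀ a b, a ≤ b → X a b = -(ckOmega ω a b * star (X b a)))
    (hY : ∀ a b, a ≤ b → Y a b = -(ckOmega ω a b * star (Y b a)))
    {a b : Fin (N + 1)} (hab : a ≤ b) (c : Fin (N + 1)) :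
    X a c * Y c b = ckOmega ω a b * star (Y b c * X c a) := by
  rw [StarMul.star_mul]
  rcases le_total a c with hac | hca
  · rcases le_total c b with hcb | hbc
    · rw [hX a c hac, hY c b hcb, ← ckOmega_mul ω hac hcb]; push_cast; ring
    · rw [hX a c hac, hY b c hbc, ← ckOmega_mul ω hab hbc]; simp; ring
  · rw [hX c a hca, hY c b (hca.trans hab), ← ckOmega_mul ω hca hab]; simp; ring

/-- The matrices `X` with `X_ab = -ω_ab conj(X_ba)` for `a ≤ b`, an explicit form of `u_ω(N+1)`. -/
noncomputable def ckExplicit {N : ℕ} (ω : Fin N → ℝ) :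
    LieSubalgebra ℝ (Matrix (Fin (N + 1)) (Fin (N + 1)) ℂ) where
  carrier := {X | ∀ a b, a ≤ b → X a b = -(ckOmega ω a b * star (X b a))}
  add_mem' {X Y} hX hY a b h := by
    rw [Matrix.add_apply, Matrix.add_apply, star_add, hX a b h, hY a b h]; ring
  zero_mem' a b h := by simp
  smul_mem' r X hX a b h := by
    rw [Matrix.smul_apply, Matrix.smul_apply, hX a b h]; simp; ring
  lie_mem' {X Y} hX hY a b h := by
    simp only [Ring.lie_def, Matrix.sub_apply, Matrix.mul_apply, star_sub, star_sum,
      Finset.mul_sum, mul_sub, ck_entry_mul ω hX hY h, ck_entry_mul ω hY hX h]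
    ring

theorem ckMatrix_mem_explicit {N : ℕ} (ω : Fin N → ℝ) (g : CKGen N) :
    ckMatrix ω g ∈ ckExplicit ω := by
  intro a b hab
  rcases g with ⟨c, d, h⟩ | ⟨c, d, h⟩ | l | _
  · have := h.ne
    simp only [ckMatrix, Matrix.add_apply, Matrix.neg_apply, Matrix.single_apply]
    split_ifs <;> simp_all <;> omega
  · have := h.ne
    simp only [ckMatrix, Matrix.smul_apply, Matrix.add_apply, Matrix.single_apply]
    split_ifs <;> simp_all <;> first | omega | ring
  · simp only [ckMatrix, Matrix.smul_apply, Matrix.sub_apply, Matrix.single_apply]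
    rcases hab.eq_or_lt with rfl | h
    · rw [ckOmega_self]
      split_ifs <;> simp
    · have h1 : ∀ c : Fin (N + 1), ¬(c = a ∧ c = b) := fun c hc => h.ne (hc.1.symm.trans hc.2)
      have h2 : ∀ c : Fin (N + 1), ¬(c = b ∧ c = a) := fun c hc => h.ne (hc.2.symm.trans hc.1)
      simp [h1, h2]
  · simp only [ckMatrix, Matrix.smul_apply, Matrix.one_apply]
    rcases hab.eq_or_lt with rfl | h
    · simp [ckOmega_self]
    · simp [h.ne, h.ne']

theorem ckExplicit_le_span {N : ℕ} (ω : Fin N → ℝ) {X : Matrix (Fin (N + 1)) (Fin (N + 1)) ℂ}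
    (hX : X ∈ ckExplicit ω) : X ∈ Submodule.span ℝ (Set.range (ckMatrix ω)) := by
  have hg : ∀ g, ckMatrix ω g ∈ Submodule.span ℝ (Set.range (ckMatrix ω)) := fun g =>
    Submodule.subset_span (Set.mem_range_self g)
  set S := Submodule.span ℝ (Set.range (ckMatrix ω))
  let D : Fin (N + 1) → Matrix (Fin (N + 1)) (Fin (N + 1)) ℂ := fun a =>
    Complex.I • Matrix.single a a 1
  have hD : ∀ a, D 0 - D a ∈ S := by
    intro a
    induction a using Fin.induction with
    | zero => simp
    | succ l ih =>
      have h := S.add_mem ih (hg (.B l))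
      simp only [ckMatrix, smul_sub] at h
      simpa [D] using h
  have hsum : ∑ a, D a = ckMatrix ω .I := by
    simp only [D, ckMatrix, ← Finset.smul_sum]
    congr 1
    ext i j
    simp [Matrix.sum_apply, Matrix.single_apply, Matrix.one_apply, ite_and]
  have hD0 : D 0 ∈ S := by
    have h : ((N + 1 : ℕ) : ℝ) • D 0 ∈ S := by
      have : ((N + 1 : ℕ) : ℝ) • D 0 = ∑ a, (D 0 - D a) + ckMatrix ω .I := by
        rw [Finset.sum_sub_distrib, hsum, sub_add_cancel]
        simp [← Nat.cast_smul_eq_nsmul ℝ]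
      rw [this]
      exact S.add_mem (S.sum_mem fun a _ => hD a) (hg _)
    exact (S.smul_mem_iff (by positivity)).mp h
  have hDa : ∀ a, D a ∈ S := fun a => by
    have := S.sub_mem hD0 (hD a)
    simpa using this
  have hdiag : ∀ a, Matrix.single a a (X a a) ∈ S := by
    intro a
    have h := hX a a le_rfl
    have hre : (X a a).re = 0 := by
      have := congrArg Complex.re h
      simp [ckOmega_self] at this
      linarith
    have : Matrix.single a a (X a a) = (X a a).im • D a := by
      ext i j
      simp only [D, Matrix.smul_apply, Matrix.single_apply]
      split_ifs
      · apply Complex.ext <;> simp [hre]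
      · simp
    rw [this]
    exact S.smul_mem _ (hDa a)
  have hoff : ∀ a b, a < b → Matrix.single a b (X a b) + Matrix.single b a (X b a) ∈ S := by
    intro a b hab
    have : Matrix.single a b (X a b) + Matrix.single b a (X b a)
        = (X b a).re • ckMatrix ω (.J a b hab) + (X b a).im • ckMatrix ω (.M a b hab) := by
      rw [hX a b hab.le]
      ext i j
      simp only [ckMatrix, Matrix.smul_apply, Matrix.add_apply, Matrix.neg_apply,
        Matrix.single_apply]
      split_ifs <;> apply Complex.ext <;> simp <;> ring
    rw [this]
    exact S.add_mem (S.smul_mem _ (hg _)) (S.smul_mem _ (hg _))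
  have key : X = ∑ a, ∑ b, ((if a < b then Matrix.single a b (X a b) + Matrix.single b a (X b a)
      else 0) + if a = b then Matrix.single a a (X a a) else 0) := by
    conv_lhs => rw [Matrix.matrix_eq_sum_single X]
    have h1 : ∀ a b : Fin (N + 1), Matrix.single a b (X a b) =
        (if a < b then Matrix.single a b (X a b) else 0)
        + (if b < a then Matrix.single a b (X a b) else 0)
        + if a = b then Matrix.single a a (X a a) else 0 := by
      intro a b
      rcases lt_trichotomy a b with h | rfl | h
      · simp [h, h.not_gt, h.ne]
      · simp
      · simp [h, h.not_gt, h.ne']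
    have h2 : ∀ a b : Fin (N + 1), (if a < b then Matrix.single a b (X a b)
        + Matrix.single b a (X b a) else 0) = (if a < b then Matrix.single a b (X a b) else 0)
        + (if a < b then Matrix.single b a (X b a) else 0) := by
      intro a b; split_ifs <;> simp
    simp only [h2]
    rw [Finset.sum_congr rfl fun a _ => Finset.sum_congr rfl fun b _ => h1 a b]
    simp only [Finset.sum_add_distrib]
    congr 2
    rw [Finset.sum_comm]
  rw [key]
  refine S.sum_mem fun a _ => S.sum_mem fun b _ => S.add_mem ?_ ?_
  · split_ifs with h
    · exact hoff a b h
    · exact S.zero_mem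
  · split_ifs with h
    · exact hdiag a
    · exact S.zero_mem

theorem uCK_toSubmodule {N : ℕ} (ω : Fin N → ℝ) :
    (uCK ω).toSubmodule = Submodule.span ℝ (Set.range (ckMatrix ω)) := by
  apply le_antisymm
  · intro X hX
    refine ckExplicit_le_span ω ?_
    exact (LieSubalgebra.lieSpan_le.mpr (by
      rintro _ ⟨g, rfl⟩; exact ckMatrix_mem_explicit ω g) : uCK ω ≤ ckExplicit ω) hX
  · exact Submodule.span_le.mpr LieSubalgebra.subset_lieSpan

/-- The coordinate functionals dual to the generators. -/
noncomputable def ckCoord {N : ℕ} :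
    CKGen N → (Matrix (Fin (N + 1)) (Fin (N + 1)) ℂ →ₗ[ℝ] ℝ)
  | .J a b _ => Complex.reLm ∘ₗ Matrix.entryLinearMap ℝ ℂ b a
  | .M a b _ => Complex.imLm ∘ₗ Matrix.entryLinearMap ℝ ℂ b a
  | .B l => ∑ a ∈ Finset.Iic l.castSucc, Complex.imLm ∘ₗ Matrix.entryLinearMap ℝ ℂ a a
      - (((l : ℕ) + 1 : ℝ) / (N + 1)) • ∑ a, Complex.imLm ∘ₗ Matrix.entryLinearMap ℝ ℂ a a
  | .I => (1 / (N + 1) : ℝ) • ∑ a, Complex.imLm ∘ₗ Matrix.entryLinearMap ℝ ℂ a a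

theorem ckMatrix_diag_JM {N : ℕ} (ω : Fin N → ℝ) (a b : Fin (N + 1)) (h : a < b)
    (x : Fin (N + 1)) :
    ckMatrix ω (.J a b h) x x = 0 ∧ ckMatrix ω (.M a b h) x x = 0 := by
  have h1 : ¬(a = x ∧ b = x) := fun hc => h.ne (hc.1.trans hc.2.symm)
  have h2 : ¬(b = x ∧ a = x) := fun hc => h1 hc.symm
  simp [ckMatrix, h1, h2]

theorem ckMatrix_diag_B {N : ℕ} (ω : Fin N → ℝ) (k : Fin N) (x : Fin (N + 1)) :
    (ckMatrix ω (.B k) x x).im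
      = (if k.castSucc = x then 1 else 0) - (if k.succ = x then 1 else 0) := by
  simp only [ckMatrix, Matrix.smul_apply, Matrix.sub_apply, Matrix.single_apply, and_self]
  split_ifs <;> simp

/-- The coordinate functionals are dual to the generators. -/
theorem ckCoord_apply {N : ℕ} (ω : Fin N → ℝ) (g h : CKGen N) [Decidable (g = h)] :
    ckCoord g (ckMatrix ω h) = if g = h then 1 else 0 := by
  have hN : ((N : ℝ) + 1) ≠ 0 := by positivity
  rcases g with ⟨c, d, hcd⟩ | ⟨c, d, hcd⟩ | l | _ <;>
    rcases h with ⟨a, b, hab⟩ | ⟨a, b, hab⟩ | k | _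
  case J.J | M.M | J.M | M.J =>
    have h1 : ¬(a = d ∧ b = c) := by rintro ⟨rfl, rfl⟩; exact lt_asymm hab hcd
    simp only [ckCoord, ckMatrix, LinearMap.comp_apply, Matrix.entryLinearMap_apply,
      Matrix.smul_apply, Matrix.add_apply, Matrix.neg_apply, Matrix.single_apply, h1, if_false,
      Complex.reLm_coe, Complex.imLm_coe, CKGen.J.injEq, CKGen.M.injEq, reduceCtorEq]
    have h4 : c = a ↔ a = c := eq_comm
    have h5 : d = b ↔ b = d := eq_comm
    by_cases h2 : b = d <;> by_cases h3 : a = c <;> simp [h2, h3, h4, h5]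
  case J.B | M.B =>
    have h1 : ∀ x, ¬(x = d ∧ x = c) := by rintro x ⟨rfl, rfl⟩; exact lt_irrefl _ hcd
    simp [ckCoord, ckMatrix, h1]
  case J.I | M.I =>
    simp [ckCoord, ckMatrix, hcd.ne']
  case B.J | I.J | B.M | I.M =>
    simp [ckCoord, LinearMap.sum_apply, (ckMatrix_diag_JM ω a b hab _).1,
      (ckMatrix_diag_JM ω a b hab _).2]
  case I.I =>
    simp [ckCoord, ckMatrix, LinearMap.sum_apply, hN]
  case B.I =>
    simp [ckCoord, ckMatrix, LinearMap.sum_apply]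
    field_simp
    simp
  case I.B =>
    simp [ckCoord, LinearMap.sum_apply, ckMatrix_diag_B, Finset.sum_sub_distrib]
  case B.B =>
    simp only [ckCoord, LinearMap.sum_apply, LinearMap.sub_apply, LinearMap.smul_apply,
      LinearMap.comp_apply, Matrix.entryLinearMap_apply, Complex.imLm_coe, ckMatrix_diag_B,
      Finset.sum_sub_distrib, Finset.sum_ite_eq, Finset.mem_univ, if_true, Finset.mem_Iic,
      CKGen.B.injEq]
    simp only [Fin.le_def, Fin.val_castSucc, Fin.val_succ, Fin.ext_iff]
    split_ifs <;> first | omega | simp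

theorem ckMatrix_linearIndependent {N : ℕ} (ω : Fin N → ℝ) :
    LinearIndependent ℝ (ckMatrix ω) := by
  classical
  rw [linearIndependent_iff']
  intro s c hs i hi
  have h := congrArg (ckCoord i) hs
  simpa [map_sum, ckCoord_apply, hi] using h

/-- The generators `J_ab`, `M_ab`, `B_l`, `I` are a basis of `u_ω(N+1)`. -/
noncomputable def ckBasis {N : ℕ} (ω : Fin N → ℝ) : Module.Basis (CKGen N) ℝ (uCK ω) :=
  (Module.Basis.span (ckMatrix_linearIndependent ω)).map
    (LinearEquiv.ofEq _ _ (uCK_toSubmodule ω).symm)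

theorem ckBasis_apply {N : ℕ} (ω : Fin N → ℝ) (g : CKGen N) : ckBasis ω g = ckGen ω g := by
  apply Subtype.ext
  simp only [ckBasis, Module.Basis.map_apply, ckGen]
  exact congrArg Subtype.val (Module.Basis.span_apply (ckMatrix_linearIndependent ω) g)

/-- The relations that the extension coefficients have to satisfy. -/
structure CKAdmissible {N : ℕ} (ω : Fin N → ℝ) (β : Fin N → Fin N → ℝ) (γ : Fin N → ℝ) :
    Prop where
  beta_left : ∀ k l, k < l → ω k * β k l = 0
  beta_right : ∀ k l, k < l → ω l * β k l = 0
  gamma : ∀ k, ω k * γ k = 0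

namespace CKExt

variable {L : Type*} [LieRing L] [LieAlgebra ℝ L]

/-- The central generator `Ξ` of an extension by the one-dimensional Lie algebra `ℝ`. -/
def Xi (E : LieAlgebra.Extension ℝ ℝ L) : E.L := E.incl 1

/-- The extension is central: `[Ξ, x] = 0` for all `x`. -/
def IsCentral (E : LieAlgebra.Extension ℝ ℝ L) : Prop := ∀ x : E.L, ⁅Xi E, x⁆ = 0

/-- Equivalence of extensions: an isomorphism that is the identity on `ℝ` and on `L`. -/
def Equivalent (E : LieAlgebra.Extension ℝ ℝ L) (E' : LieAlgebra.Extension ℝ ℝ L) : Prop :=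
  ∃ φ : E.L ≃ₗ⁅ℝ⁆ E'.L, (∀ t : ℝ, φ (E.incl t) = E'.incl t) ∧
    ∀ x : E.L, E'.proj (φ x) = E.proj x

/-- The extension is trivial: a Lie algebra homomorphism splits it, that is, generators can be
lifted so that all terms in `Ξ` disappear from their commutators. -/
def IsTrivial (E : LieAlgebra.Extension ℝ ℝ L) : Prop :=
  ∃ s : L →ₗ⁅ℝ⁆ E.L, ∀ x : L, E.proj (s x) = x

/-- The extension can be written with the coefficients `α, β, γ`: the generators of `u_ω(N+1)`
have lifts that satisfy, together with `Ξ`, the corresponding commutation relations. -/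
def HasCoefficients {N : ℕ} {ω : Fin N → ℝ} (E : LieAlgebra.Extension ℝ ℝ (uCK ω))
    (α : Fin N → ℝ) (β : Fin N → Fin N → ℝ) (γ : Fin N → ℝ) : Prop :=
  ∃ X : CKGen N → E.L, (∀ g, E.proj (X g) = ckGen ω g) ∧ CKRelations ω X (Xi E) α β γ

end CKExt

/-! In a central extension a bracket depends only on the images of its arguments, and a diagonal
element `i ∑ h_a e_aa` rotates the plane of `J_ab` and `M_ab` with weight `h_a - h_b`. Replacing the
lifts of `J_ab` and `M_ab` by brackets with lifted diagonal elements removes every central term from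
this action (`CKExt.exists_isAdapted`). Brackets of root vectors with different index pairs then
have no central term either, because some diagonal element annihilates one factor and squares to
`-1` on the other (`CKExt.IsAdapted.lie_eq`). Only `[J_ab, M_ab]`, `[B_k, B_l]` and `[B_k, I]` can
retain a multiple of `Ξ`. In the first family the Jacobi identity reduces everything to neighbouring
indices: the coefficient obeys the Leibniz rule of the derivative of `ω_ab` in direction `α`
(`CKExt.IsAdapted.lie_J_M`).

The conditions on `β` and `γ` are the Jacobi identity for `J_{k-1,k}`, `M_{k-1,k}` and a further
diagonal generator. An `α_k` with `ω_k ≠ 0` is absorbed by shifting `B_k` along `Ξ`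
(`CKRelations.change_alpha`); all other coefficients are read off from brackets that do not depend
on the lifts (`CKExt.HasCoefficients.unique`). Equal coefficients give isomorphic extensions, since
a linear map matching the lifts and `Ξ` respects brackets (`CKRelations.map_lie`).

For existence a 2-cocycle is written down. Its `α`-part is the first-order variation in `ε` of the
reality of the trace form on the family `u_{ω + ε α}`; cyclicity of the trace gives the cocycle
identity (`trace_upperDeriv_cyclic`). Its `β`- and `γ`-parts are wedge products of linear
functionals vanishing on all commutators: the `I`-coordinate always does, and the `B_k`-coordinate
does when `ω_k = 0` (`ckCoord_B_lie`). -/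

/-! ### Linear maps between algebras with the same commutation relations. -/

theorem CKRelations.map_lie_gen {N : ℕ} {ω : Fin N → ℝ} {L₁ L₂ : Type*} [LieRing L₁]
    [LieAlgebra ℝ L₁] [LieRing L₂] [LieAlgebra ℝ L₂] {X₁ : CKGen N → L₁} {X₂ : CKGen N → L₂}
    {Ξ₁ : L₁} {Ξ₂ : L₂} {α : Fin N → ℝ} {β : Fin N → Fin N → ℝ} {γ : Fin N → ℝ}
    (R₁ : CKRelations ω X₁ Ξ₁ α β γ) (R₂ : CKRelations ω X₂ Ξ₂ α β γ)
    (f : L₁ →ₗ[ℝ] L₂) (hX : ∀ g, f (X₁ g) = X₂ g) (hΞ : f Ξ₁ = Ξ₂) (g h : CKGen N) :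
    f ⁅X₁ g, X₁ h⁆ = ⁅X₂ g, X₂ h⁆ := by
  -- Each bracket of generators is, up to order, the left side of one relation, and the right sides
  -- are the same linear expressions in the generators and `Ξ`. Antisymmetry leaves one order to
  -- check.
  have swap : ∀ g h, f ⁅X₁ g, X₁ h⁆ = ⁅X₂ g, X₂ h⁆ → f ⁅X₁ h, X₁ g⁆ = ⁅X₂ h, X₂ g⁆ := by
    intro g h hgh
    rw [← lie_skew, map_neg, hgh, lie_skew]
  have hJJ : ∀ a b hab d e hde, f ⁅X₁ (.J a b hab), X₁ (.J d e hde)⁆ =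
      ⁅X₂ (.J a b hab), X₂ (.J d e hde)⁆ := by
    intro a b hab d e hde
    by_cases had : a = d
    · subst had
      rcases lt_trichotomy b e with h | rfl | h
      · rw [R₁.JJ_ab_ac _ _ _ hab h, R₂.JJ_ab_ac _ _ _ hab h, map_smul, hX]
      · simp
      · apply swap
        rw [R₁.JJ_ab_ac _ _ _ hde h, R₂.JJ_ab_ac _ _ _ hde h, map_smul, hX]
    by_cases hbe : b = e
    · subst hbe
      rcases lt_or_gt_of_ne had with h | h
      · rw [R₁.JJ_ac_bc _ _ _ h hde, R₂.JJ_ac_bc _ _ _ h hde, map_smul, hX]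
      · apply swap
        rw [R₁.JJ_ac_bc _ _ _ h hab, R₂.JJ_ac_bc _ _ _ h hab, map_smul, hX]
    by_cases hbd : b = d
    · subst hbd
      rw [R₁.JJ_ab_bc _ _ _ hab hde, R₂.JJ_ab_bc _ _ _ hab hde, map_neg, hX]
    by_cases hae : a = e
    · subst hae
      apply swap
      rw [R₁.JJ_ab_bc _ _ _ hde hab, R₂.JJ_ab_bc _ _ _ hde hab, map_neg, hX]
    rw [R₁.JJ_disjoint _ _ _ _ hab hde had hae hbd hbe,
      R₂.JJ_disjoint _ _ _ _ hab hde had hae hbd hbe, map_zero]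
  have hMM : ∀ a b hab d e hde, f ⁅X₁ (.M a b hab), X₁ (.M d e hde)⁆ =
      ⁅X₂ (.M a b hab), X₂ (.M d e hde)⁆ := by
    intro a b hab d e hde
    by_cases had : a = d
    · subst had
      rcases lt_trichotomy b e with h | rfl | h
      · rw [R₁.MM_ab_ac _ _ _ hab h, R₂.MM_ab_ac _ _ _ hab h, map_smul, hX]
      · simp
      · apply swap
        rw [R₁.MM_ab_ac _ _ _ hde h, R₂.MM_ab_ac _ _ _ hde h, map_smul, hX]
    by_cases hbe : b = e
    · subst hbe
      rcases lt_or_gt_of_ne had with h | h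
      · rw [R₁.MM_ac_bc _ _ _ h hde, R₂.MM_ac_bc _ _ _ h hde, map_smul, hX]
      · apply swap
        rw [R₁.MM_ac_bc _ _ _ h hab, R₂.MM_ac_bc _ _ _ h hab, map_smul, hX]
    by_cases hbd : b = d
    · subst hbd
      rw [R₁.MM_ab_bc _ _ _ hab hde, R₂.MM_ab_bc _ _ _ hab hde, hX]
    by_cases hae : a = e
    · subst hae
      apply swap
      rw [R₁.MM_ab_bc _ _ _ hde hab, R₂.MM_ab_bc _ _ _ hde hab, hX]
    rw [R₁.MM_disjoint _ _ _ _ hab hde had hae hbd hbe,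
      R₂.MM_disjoint _ _ _ _ hab hde had hae hbd hbe, map_zero]
  have hJM : ∀ a b hab d e hde, f ⁅X₁ (.J a b hab), X₁ (.M d e hde)⁆ =
      ⁅X₂ (.J a b hab), X₂ (.M d e hde)⁆ := by
    intro a b hab d e hde
    by_cases had : a = d
    · subst had
      rcases lt_trichotomy b e with h | rfl | h
      · rw [R₁.JM_ab_ac _ _ _ hab h, R₂.JM_ab_ac _ _ _ hab h, map_smul, hX]
      · rw [R₁.JM_ab_ab, R₂.JM_ab_ab]
        simp [hX, hΞ]
      · apply swap
        rw [R₁.MJ_ab_ac _ _ _ hde h, R₂.MJ_ab_ac _ _ _ hde h, map_neg, map_smul, hX]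
    by_cases hbe : b = e
    · subst hbe
      rcases lt_or_gt_of_ne had with h | h
      · rw [R₁.JM_ac_bc _ _ _ h hde, R₂.JM_ac_bc _ _ _ h hde, map_neg, map_smul, hX]
      · apply swap
        rw [R₁.MJ_ac_bc _ _ _ h hab, R₂.MJ_ac_bc _ _ _ h hab, map_smul, hX]
    by_cases hbd : b = d
    · subst hbd
      rw [R₁.JM_ab_bc _ _ _ hab hde, R₂.JM_ab_bc _ _ _ hab hde, map_neg, hX]
    by_cases hae : a = e
    · subst hae
      apply swap
      rw [R₁.MJ_ab_bc _ _ _ hde hab, R₂.MJ_ab_bc _ _ _ hde hab, map_neg, hX]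
    rw [R₁.JM_disjoint _ _ _ _ hab hde had hae hbd hbe,
      R₂.JM_disjoint _ _ _ _ hab hde had hae hbd hbe, map_zero]
  have hJB : ∀ a b hab l, f ⁅X₁ (.J a b hab), X₁ (.B l)⁆ = ⁅X₂ (.J a b hab), X₂ (.B l)⁆ := by
    intro a b hab l
    rw [R₁.JB, R₂.JB, map_smul, hX]
  have hMB : ∀ a b hab l, f ⁅X₁ (.M a b hab), X₁ (.B l)⁆ = ⁅X₂ (.M a b hab), X₂ (.B l)⁆ := by
    intro a b hab l
    rw [R₁.MB, R₂.MB, map_neg, map_smul, hX]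
  have hJI : ∀ a b hab, f ⁅X₁ (.J a b hab), X₁ .I⁆ = ⁅X₂ (.J a b hab), X₂ .I⁆ := by
    intro a b hab
    rw [R₁.JI, R₂.JI, map_zero]
  have hMI : ∀ a b hab, f ⁅X₁ (.M a b hab), X₁ .I⁆ = ⁅X₂ (.M a b hab), X₂ .I⁆ := by
    intro a b hab
    rw [R₁.MI, R₂.MI, map_zero]
  have hBI : ∀ k, f ⁅X₁ (.B k), X₁ .I⁆ = ⁅X₂ (.B k), X₂ .I⁆ := by
    intro k
    rw [R₁.BI, R₂.BI, map_smul, hΞ]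
  rcases g with ⟨a, b, hab⟩ | ⟨a, b, hab⟩ | k | _ <;> rcases h with ⟨d, e, hde⟩ | ⟨d, e, hde⟩ | l | _
  · exact hJJ ..
  · exact hJM ..
  · exact hJB ..
  · exact hJI ..
  · exact swap _ _ (hJM ..)
  · exact hMM ..
  · exact hMB ..
  · exact hMI ..
  · exact swap _ _ (hJB ..)
  · exact swap _ _ (hMB ..)
  · rcases lt_trichotomy k l with h | rfl | h
    · rw [R₁.BB _ _ h, R₂.BB _ _ h, map_smul, hΞ]
    · simp
    · apply swap
      rw [R₁.BB _ _ h, R₂.BB _ _ h, map_smul, hΞ]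
  · exact hBI ..
  · exact swap _ _ (hJI ..)
  · exact swap _ _ (hMI ..)
  · exact swap _ _ (hBI ..)
  · simp

/-- A linear map that matches two systems of generators with the same commutation relations is
compatible with the Lie brackets. -/
theorem CKRelations.map_lie {N : ℕ} {ω : Fin N → ℝ} {L₁ L₂ : Type*} [LieRing L₁]
    [LieAlgebra ℝ L₁] [LieRing L₂] [LieAlgebra ℝ L₂] {X₁ : CKGen N → L₁} {X₂ : CKGen N → L₂}
    {Ξ₁ : L₁} {Ξ₂ : L₂} {α : Fin N → ℝ} {β : Fin N → Fin N → ℝ} {γ : Fin N → ℝ}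
    (R₁ : CKRelations ω X₁ Ξ₁ α β γ) (R₂ : CKRelations ω X₂ Ξ₂ α β γ)
    (hc₁ : ∀ x : L₁, ⁅Ξ₁, x⁆ = 0) (hc₂ : ∀ x : L₂, ⁅Ξ₂, x⁆ = 0)
    (f : L₁ →ₗ[ℝ] L₂) (hX : ∀ g, f (X₁ g) = X₂ g) (hΞ : f Ξ₁ = Ξ₂)
    (hspan : ∀ x, x ∈ Submodule.span ℝ (insert Ξ₁ (Set.range X₁))) (x y : L₁) :
    f ⁅x, y⁆ = ⁅f x, f y⁆ := by
  have hc₁' : ∀ x, ⁅x, Ξ₁⁆ = 0 := fun x => by rw [← lie_skew, hc₁, neg_zero]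
  have hc₂' : ∀ x, ⁅x, Ξ₂⁆ = 0 := fun x => by rw [← lie_skew, hc₂, neg_zero]
  induction hspan x using Submodule.span_induction with
  | mem x hx =>
    induction hspan y using Submodule.span_induction with
    | mem y hy =>
      rcases hx with rfl | ⟨g, rfl⟩
      · rw [hc₁, hΞ, hc₂, map_zero]
      · rcases hy with rfl | ⟨h, rfl⟩
        · rw [hc₁', hΞ, hc₂', map_zero]
        · rw [R₁.map_lie_gen R₂ f hX hΞ, hX, hX]
    | zero => simp
    | add y z _ _ hy hz => simp [hy, hz]
    | smul r y _ hy => simp [hy]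
  | zero => simp
  | add x z _ _ hx hz => simp [hx, hz]
  | smul r x _ hx => simp [hx]

/-! ### Central extensions by a line, and linear sections given by lifts. -/

namespace CKExt

section General

variable {L : Type*} [LieRing L] [LieAlgebra ℝ L]

theorem Xi_ne_zero (E : LieAlgebra.Extension ℝ ℝ L) : Xi E ≠ 0 := by
  intro h
  have : (1 : ℝ) = 0 := E.incl_injective (by rw [map_zero]; exact h)
  exact one_ne_zero this

theorem incl_eq_smul_Xi (E : LieAlgebra.Extension ℝ ℝ L) (t : ℝ) : E.incl t = t • Xi E := by
  rw [Xi, ← map_smul, smul_eq_mul, mul_one]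

theorem proj_Xi (E : LieAlgebra.Extension ℝ ℝ L) : E.proj (Xi E) = 0 := E.proj_incl 1

theorem exists_eq_smul_Xi (E : LieAlgebra.Extension ℝ ℝ L) {x : E.L} (h : E.proj x = 0) :
    ∃ t : ℝ, x = t • Xi E := by
  obtain ⟨t, rfl⟩ := ((LieHom.range_eq_ker_iff _ _).mp E.IsExtension.exact x).mp h
  exact ⟨t, incl_eq_smul_Xi E t⟩

theorem exists_eq_add_smul_Xi (E : LieAlgebra.Extension ℝ ℝ L) {x y : E.L}
    (h : E.proj x = E.proj y) : ∃ t : ℝ, x = y + t • Xi E := by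
  obtain ⟨t, ht⟩ := exists_eq_smul_Xi E (x := x - y) (by rw [map_sub, h, sub_self])
  exact ⟨t, by rw [← ht]; abel⟩

variable {E : LieAlgebra.Extension ℝ ℝ L}

theorem IsCentral.lie_Xi (hE : IsCentral E) (x : E.L) : ⁅x, Xi E⁆ = 0 := by
  rw [← lie_skew, hE, neg_zero]

theorem IsCentral.lie_eq_zero (hE : IsCentral E) {x : E.L} (hx : E.proj x = 0) (y : E.L) :
    ⁅x, y⁆ = 0 := by
  obtain ⟨t, rfl⟩ := exists_eq_smul_Xi E hx
  rw [smul_lie, hE, smul_zero]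

/-- In a central extension the bracket depends only on the images of its arguments. -/
theorem IsCentral.lie_congr (hE : IsCentral E) {x x' y y' : E.L} (hx : E.proj x = E.proj x')
    (hy : E.proj y = E.proj y') : ⁅x, y⁆ = ⁅x', y'⁆ := by
  obtain ⟨t, rfl⟩ := exists_eq_add_smul_Xi E hx
  obtain ⟨r, rfl⟩ := exists_eq_add_smul_Xi E hy
  simp [hE.lie_Xi, hE _]

end General

section Lifts

variable {N : ℕ} {ω : Fin N → ℝ} {E : LieAlgebra.Extension ℝ ℝ (uCK ω)}

/-- The linear section of an extension given by lifts of the generators. -/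
noncomputable def liftSection (E : LieAlgebra.Extension ℝ ℝ (uCK ω)) (X : CKGen N → E.L) :
    uCK ω →ₗ[ℝ] E.L :=
  (ckBasis ω).constr ℝ X

theorem liftSection_gen (X : CKGen N → E.L) (g : CKGen N) :
    liftSection E X (ckGen ω g) = X g := by
  rw [← ckBasis_apply, liftSection, Module.Basis.constr_basis]

theorem proj_liftSection {X : CKGen N → E.L} (hX : ∀ g, E.proj (X g) = ckGen ω g) (u : uCK ω) :
    E.proj (liftSection E X u) = u := by
  have : (E.proj : E.L →ₗ[ℝ] uCK ω) ∘ₗ liftSection E X = LinearMap.id := by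
    refine (ckBasis ω).ext fun g => ?_
    simp [ckBasis_apply, liftSection_gen, hX]
  exact LinearMap.congr_fun this u

theorem span_ckGen (u : uCK ω) : u ∈ Submodule.span ℝ (Set.range (ckGen ω)) := by
  have h : ⇑(ckBasis ω) = ckGen ω := funext (ckBasis_apply ω)
  rw [← h, (ckBasis ω).span_eq]
  trivial

/-- An element differs from the section of its own projection by a multiple of `Ξ`, and the section
takes values in the span of the lifts. -/
theorem span_lifts {X : CKGen N → E.L} (hX : ∀ g, E.proj (X g) = ckGen ω g) (x : E.L) :
    x ∈ Submodule.span ℝ (insert (Xi E) (Set.range X)) := by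
  obtain ⟨t, ht⟩ := exists_eq_add_smul_Xi E (x := x) (y := liftSection E X (E.proj x))
    (proj_liftSection hX _).symm
  rw [ht]
  refine add_mem ?_ (Submodule.smul_mem _ _ (Submodule.subset_span (Set.mem_insert _ _)))
  have hle : Submodule.span ℝ (Set.range (ckGen ω)) ≤
      (Submodule.span ℝ (insert (Xi E) (Set.range X))).comap (liftSection E X) := by
    refine Submodule.span_le.mpr ?_
    rintro _ ⟨g, rfl⟩
    rw [SetLike.mem_coe, Submodule.mem_comap, liftSection_gen]
    exact Submodule.subset_span (Set.mem_insert_of_mem _ (Set.mem_range_self g))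
  exact hle (span_ckGen _)

/-- The coordinate of `Ξ` with respect to lifts of the generators. -/
theorem exists_retraction {X : CKGen N → E.L} (hX : ∀ g, E.proj (X g) = ckGen ω g) :
    ∃ r : E.L →ₗ[ℝ] ℝ, r (Xi E) = 1 ∧ ∀ g, r (X g) = 0 := by
  obtain ⟨r, hr⟩ := LinearMap.exists_leftInverse_of_injective (E.incl : ℝ →ₗ[ℝ] E.L)
    (LinearMap.ker_eq_bot.mpr E.incl_injective)
  -- A left inverse of the inclusion need not vanish on the lifts. Subtracting the section of the
  -- projection first kills every `X g` and leaves `Ξ`, which projects to zero, unchanged.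
  refine ⟨r ∘ₗ (LinearMap.id - liftSection E X ∘ₗ (E.proj : E.L →ₗ[ℝ] uCK ω)), ?_, fun g => ?_⟩
  · have := LinearMap.congr_fun hr 1
    simpa [Xi] using this
  · simp [hX, liftSection_gen]

end Lifts

end CKExt

/-! ### Consequences of the relations: constraints on the coefficients and change of lifts. -/

theorem ckBetween_castSucc_succ {N : ℕ} (k : Fin N) :
    ckBetween k.castSucc k.succ = {k} := by
  ext s
  simp only [ckBetween, Finset.mem_filter, Finset.mem_univ, true_and, Finset.mem_singleton,
    Fin.le_def, Fin.lt_def, Fin.ext_iff, Fin.val_castSucc, Fin.val_succ]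
  omega

theorem ckOmega_castSucc_succ {N : ℕ} (ω : Fin N → ℝ) (k : Fin N) :
    ckOmega ω k.castSucc k.succ = ω k := by
  rw [ckOmega, ckBetween_castSucc_succ, Finset.prod_singleton]

namespace CKRelations

variable {N : ℕ} {ω : Fin N → ℝ} {L : Type*} [LieRing L] [LieAlgebra ℝ L] {X : CKGen N → L}
  {Ξ : L} {α : Fin N → ℝ} {β : Fin N → Fin N → ℝ} {γ : Fin N → ℝ}

theorem map (R : CKRelations ω X Ξ α β γ) {L' : Type*} [LieRing L'] [LieAlgebra ℝ L']
    (f : L →ₗ⁅ℝ⁆ L') : CKRelations ω (fun g => f (X g)) (f Ξ) α β γ :=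
  {
    JJ_ab_ac := fun a b c hab hbc => by simpa using congrArg f (R.JJ_ab_ac a b c hab hbc)
    JJ_ab_bc := fun a b c hab hbc => by simpa using congrArg f (R.JJ_ab_bc a b c hab hbc)
    JJ_ac_bc := fun a b c hab hbc => by simpa using congrArg f (R.JJ_ac_bc a b c hab hbc)
    MM_ab_ac := fun a b c hab hbc => by simpa using congrArg f (R.MM_ab_ac a b c hab hbc)
    MM_ab_bc := fun a b c hab hbc => by simpa using congrArg f (R.MM_ab_bc a b c hab hbc)
    MM_ac_bc := fun a b c hab hbc => by simpa using congrArg f (R.MM_ac_bc a b c hab hbc)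
    JM_ab_ac := fun a b c hab hbc => by simpa using congrArg f (R.JM_ab_ac a b c hab hbc)
    JM_ab_bc := fun a b c hab hbc => by simpa using congrArg f (R.JM_ab_bc a b c hab hbc)
    JM_ac_bc := fun a b c hab hbc => by simpa using congrArg f (R.JM_ac_bc a b c hab hbc)
    MJ_ab_ac := fun a b c hab hbc => by simpa using congrArg f (R.MJ_ab_ac a b c hab hbc)
    MJ_ab_bc := fun a b c hab hbc => by simpa using congrArg f (R.MJ_ab_bc a b c hab hbc)
    MJ_ac_bc := fun a b c hab hbc => by simpa using congrArg f (R.MJ_ac_bc a b c hab hbc)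
    JJ_disjoint := fun a b d e hab hde h1 h2 h3 h4 => by
      simpa using congrArg f (R.JJ_disjoint a b d e hab hde h1 h2 h3 h4)
    MM_disjoint := fun a b d e hab hde h1 h2 h3 h4 => by
      simpa using congrArg f (R.MM_disjoint a b d e hab hde h1 h2 h3 h4)
    JM_disjoint := fun a b d e hab hde h1 h2 h3 h4 => by
      simpa using congrArg f (R.JM_disjoint a b d e hab hde h1 h2 h3 h4)
    JB := fun a b hab l => by simpa using congrArg f (R.JB a b hab l)
    MB := fun a b hab l => by simpa using congrArg f (R.MB a b hab l)
    JM_ab_ab := fun a b hab => by simpa using congrArg f (R.JM_ab_ab a b hab)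
    BB := fun k l hkl => by simpa using congrArg f (R.BB k l hkl)
    JI := fun a b hab => by simpa using congrArg f (R.JI a b hab)
    MI := fun a b hab => by simpa using congrArg f (R.MI a b hab)
    BI := fun k => by simpa using congrArg f (R.BI k) }

theorem congr_coeff (R : CKRelations ω X Ξ α β γ) {β' : Fin N → Fin N → ℝ} {γ' : Fin N → ℝ}
    (hβ : ∀ k l, k < l → β k l = β' k l) (hγ : ∀ k, γ k = γ' k) : CKRelations ω X Ξ α β' γ' :=
  { R with
    BB := fun k l hkl => by rw [R.BB k l hkl, hβ k l hkl]
    BI := fun k => by rw [R.BI k, hγ k] }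

/-- For `J = J_{k-1,k}` and `M = M_{k-1,k}` the bracket is `[J, M] = -2 ω_k B_k + α_k Ξ`. -/
theorem lie_J_M_succ (R : CKRelations ω X Ξ α β γ) (k : Fin N) :
    ⁅X (.J k.castSucc k.succ k.castSucc_lt_succ), X (.M k.castSucc k.succ k.castSucc_lt_succ)⁆ =
      (-2 * ω k) • X (.B k) + α k • Ξ := by
  rw [R.JM_ab_ab, ckBetween_castSucc_succ, ckOmega_castSucc_succ]
  simp [ckOmega_self]

/-- Jacobi for `J_{k-1,k}`, `M_{k-1,k}`, `B_l`: bracketing with `B_l` turns `J` into a multiple of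
`M` and conversely, so only `[J, J]` and `[M, M]` occur on one side, while the other is `-2 ω_k
[B_k, B_l]`. -/
theorem omega_smul_lie_B_B (R : CKRelations ω X Ξ α β γ) (hc : ∀ x : L, ⁅Ξ, x⁆ = 0)
    (k l : Fin N) : ω k • ⁅X (.B k), X (.B l)⁆ = 0 := by
  have h := lie_lie (X (.J k.castSucc k.succ k.castSucc_lt_succ))
    (X (.M k.castSucc k.succ k.castSucc_lt_succ)) (X (.B l))
  rw [R.lie_J_M_succ, R.JB, R.MB] at h
  simpa [hc] using h

/-- The same Jacobi argument with `I`, which commutes with both `J_{k-1,k}` and `M_{k-1,k}`. -/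
theorem omega_smul_lie_B_I (R : CKRelations ω X Ξ α β γ) (hc : ∀ x : L, ⁅Ξ, x⁆ = 0)
    (k : Fin N) : ω k • ⁅X (.B k), X .I⁆ = 0 := by
  have h := lie_lie (X (.J k.castSucc k.succ k.castSucc_lt_succ))
    (X (.M k.castSucc k.succ k.castSucc_lt_succ)) (X .I)
  rw [R.lie_J_M_succ, R.JI, R.MI] at h
  simpa [hc] using h

theorem admissible (R : CKRelations ω X Ξ α β γ) (hc : ∀ x : L, ⁅Ξ, x⁆ = 0) (hΞ : Ξ ≠ 0) :
    CKAdmissible ω β γ where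
  beta_left k l hkl := by
    have h := R.omega_smul_lie_B_B hc k l
    rw [R.BB k l hkl, smul_smul] at h
    exact (smul_eq_zero.mp h).resolve_right hΞ
  beta_right k l hkl := by
    have h := R.omega_smul_lie_B_B hc l k
    rw [← lie_skew, R.BB k l hkl, smul_neg, neg_eq_zero, smul_smul] at h
    exact (smul_eq_zero.mp h).resolve_right hΞ
  gamma k := by
    have h := R.omega_smul_lie_B_I hc k
    rw [R.BI k, smul_smul] at h
    exact (smul_eq_zero.mp h).resolve_right hΞ

/-- Lifts of the `B_l` can be changed by central elements so as to change `α_l` arbitrarily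
where `ω_l ≠ 0`. -/
theorem change_alpha (R : CKRelations ω X Ξ α β γ) (hc : ∀ x : L, ⁅Ξ, x⁆ = 0)
    {α' : Fin N → ℝ} (hα : ∀ k, ω k = 0 → α k = α' k) :
    ∃ t : Fin N → ℝ, CKRelations ω
      (fun g => match g with | .B l => X (.B l) + t l • Ξ | g => X g) Ξ α' β γ := by
  have hc' : ∀ x : L, ⁅x, Ξ⁆ = 0 := fun x => by rw [← lie_skew, hc, neg_zero]
  -- Since `ω_ab = ω_{a,s-1} ω_s ω_{sb}`, the shift of `B_s` changes the coefficient of `Ξ` by `-2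
  -- ω_s t_s` times `ω_{a,s-1} ω_{sb}`, which dictates `t_s`. For `ω_s = 0` the quotient is `0` by
  -- convention and `B_s` is left alone.
  refine ⟨fun l => (α' l - α l) / (2 * ω l), { R with
    JB := fun a b hab l => by simp [hc', R.JB]
    MB := fun a b hab l => by simp [hc', R.MB]
    BB := fun k l hkl => by simp [hc, hc', R.BB k l hkl]
    BI := fun k => by simp [hc, R.BI]
    JM_ab_ab := fun a b hab => ?_ }⟩
  simp only [R.JM_ab_ab a b hab, Finset.sum_add_distrib, ← Finset.sum_smul, smul_add, smul_smul,
    add_assoc, ← add_smul]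
  congr 2
  rw [Finset.mul_sum, ← Finset.sum_add_distrib]
  refine Finset.sum_congr rfl fun s hs => ?_
  have hs' : a ≤ s.castSucc ∧ s.succ ≤ b := by
    simpa [ckBetween, Fin.le_def, Fin.lt_def, Nat.succ_le_iff] using hs
  rw [← ckOmega_mul ω hs'.1 (s.castSucc_lt_succ.le.trans hs'.2),
    ← ckOmega_mul ω s.castSucc_lt_succ.le hs'.2, ckOmega_castSucc_succ]
  by_cases h0 : ω s = 0
  · simp [h0, hα s h0]
  · field_simp
    ring

end CKRelations

/-! ### Equivalence and triviality in terms of the coefficients. -/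

namespace CKExt

variable {N : ℕ} {ω : Fin N → ℝ} {α α' : Fin N → ℝ} {β β' : Fin N → Fin N → ℝ}
  {γ γ' : Fin N → ℝ}

/-- Brackets of lifts do not depend on the lifts chosen, and `Ξ ≠ 0`, so coefficients of `Ξ` can be
compared. In `[J_{k-1,k}, M_{k-1,k}]` the term in the lift-dependent `B_k` disappears exactly when
`ω_k = 0`. -/
theorem HasCoefficients.unique {E : LieAlgebra.Extension ℝ ℝ (uCK ω)} (hE : IsCentral E)
    (h : HasCoefficients E α β γ) (h' : HasCoefficients E α' β' γ') :
    (∀ k, ω k = 0 → α k = α' k) ∧ (∀ k l, k < l → β k l = β' k l) ∧ ∀ k, γ k = γ' k := by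
  obtain ⟨X, hX, R⟩ := h
  obtain ⟨X', hX', R'⟩ := h'
  have hlie : ∀ g g', ⁅X g, X g'⁆ = ⁅X' g, X' g'⁆ := fun g g' =>
    hE.lie_congr ((hX g).trans (hX' g).symm) ((hX g').trans (hX' g').symm)
  have hinj := smul_left_injective ℝ (Xi_ne_zero E)
  refine ⟨fun k hk => hinj ?_, fun k l hkl => hinj ?_, fun k => hinj ?_⟩
  · have h := hlie (.J k.castSucc k.succ k.castSucc_lt_succ)
      (.M k.castSucc k.succ k.castSucc_lt_succ)
    rw [R.lie_J_M_succ, R'.lie_J_M_succ] at h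
    simpa [hk] using h
  · simpa only [R.BB k l hkl, R'.BB k l hkl] using hlie (.B k) (.B l)
  · simpa only [R.BI k, R'.BI k] using hlie (.B k) .I

theorem HasCoefficients.of_equivalent {E E' : LieAlgebra.Extension ℝ ℝ (uCK ω)}
    (h : HasCoefficients E α β γ) (hEE' : Equivalent E E') : HasCoefficients E' α β γ := by
  obtain ⟨X, hX, R⟩ := h
  obtain ⟨φ, hφ, hφ'⟩ := hEE'
  refine ⟨fun g => φ (X g), fun g => by rw [hφ', hX], ?_⟩
  have := R.map (φ : E.L →ₗ⁅ℝ⁆ E'.L)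
  rwa [show (φ : E.L →ₗ⁅ℝ⁆ E'.L) (Xi E) = Xi E' from hφ 1] at this

theorem HasCoefficients.change {E : LieAlgebra.Extension ℝ ℝ (uCK ω)} (hE : IsCentral E)
    (h : HasCoefficients E α β γ) (hα : ∀ k, ω k = 0 → α k = α' k)
    (hβ : ∀ k l, k < l → β k l = β' k l) (hγ : ∀ k, γ k = γ' k) :
    HasCoefficients E α' β' γ' := by
  obtain ⟨X, hX, R⟩ := h
  obtain ⟨t, Rt⟩ := R.change_alpha hE hα
  refine ⟨_, fun g => ?_, Rt.congr_coeff hβ hγ⟩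
  cases g <;> simp [hX, proj_Xi]

/-- Two central extensions with the same coefficients are equivalent. -/
theorem HasCoefficients.equivalent {E E' : LieAlgebra.Extension ℝ ℝ (uCK ω)} (hE : IsCentral E)
    (hE' : IsCentral E') (h : HasCoefficients E α β γ) (h' : HasCoefficients E' α β γ) :
    Equivalent E E' := by
  obtain ⟨X, hX, R⟩ := h
  obtain ⟨X', hX', R'⟩ := h'
  obtain ⟨r, hr1, hr0⟩ := exists_retraction hX
  -- In the splittings of `E` and `E'` given by the lifts, this map is the identity on both the
  -- `u_ω`-part and the `Ξ`-coordinate.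
  let f : E.L →ₗ[ℝ] E'.L := liftSection E' X' ∘ₗ (E.proj : E.L →ₗ[ℝ] uCK ω) +
    (E'.incl : ℝ →ₗ[ℝ] E'.L) ∘ₗ r
  have hf : ∀ x, f x = liftSection E' X' (E.proj x) + E'.incl (r x) := fun x => rfl
  have hfX : ∀ g, f (X g) = X' g := fun g => by
    rw [hf, hX, liftSection_gen, hr0, map_zero, add_zero]
  have hfΞ : f (Xi E) = Xi E' := by
    rw [hf, proj_Xi, hr1, map_zero, zero_add, Xi]
  have hproj : ∀ x, E'.proj (f x) = E.proj x := fun x => by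
    rw [hf, map_add, proj_liftSection hX', LieAlgebra.Extension.proj_incl, add_zero]
  let F : E.L →ₗ⁅ℝ⁆ E'.L :=
    { f with map_lie' := fun {x y} => R.map_lie R' hE hE' f hfX hfΞ (span_lifts hX) x y }
  have hbij : Function.Bijective F := by
    constructor
    · refine (injective_iff_map_eq_zero F).mpr fun x hx => ?_
      obtain ⟨t, rfl⟩ := exists_eq_smul_Xi E (x := x) (by
        rw [← hproj, show f x = 0 from hx, map_zero])
      have h0 : t • Xi E' = 0 := by rw [← hfΞ, ← map_smul]; exact hx
      rw [(smul_eq_zero.mp h0).resolve_right (Xi_ne_zero E'), zero_smul]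
    · intro y
      obtain ⟨x, hx⟩ := E.proj_surjective (E'.proj y)
      obtain ⟨t, ht⟩ := exists_eq_add_smul_Xi E' (x := y) (y := f x) (by rw [hproj, hx])
      refine ⟨x + t • Xi E, ?_⟩
      change f (x + t • Xi E) = y
      rw [map_add, map_smul, hfΞ, ht]
  refine ⟨LieEquiv.ofBijective F hbij, fun t => ?_, hproj⟩
  change f (E.incl t) = _
  rw [incl_eq_smul_Xi, map_smul, hfΞ, incl_eq_smul_Xi]

theorem HasCoefficients.equivalent_iff {E E' : LieAlgebra.Extension ℝ ℝ (uCK ω)}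
    (hE : IsCentral E) (hE' : IsCentral E') (h : HasCoefficients E α β γ)
    (h' : HasCoefficients E' α' β' γ') : Equivalent E E' ↔
      (∀ k, ω k = 0 → α k = α' k) ∧ (∀ k l, k < l → β k l = β' k l) ∧ ∀ k, γ k = γ' k :=
  ⟨fun hEE' => (h.of_equivalent hEE').unique hE' h',
    fun ⟨hα, hβ, hγ⟩ => (h.change hE hα hβ hγ).equivalent hE hE' h'⟩

/-- With zero coefficients `Ξ` drops out of the relations, so the lifts satisfy those of `u_ω(N+1)`
itself and the linear section through them is a homomorphism. -/
theorem isTrivial_iff_hasCoefficients_zero {E : LieAlgebra.Extension ℝ ℝ (uCK ω)} :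
    IsTrivial E ↔ HasCoefficients E (0 : Fin N → ℝ) 0 0 := by
  constructor
  · rintro ⟨s, hs⟩
    have R := (ckGen_relations ω).map s
    rw [map_zero] at R
    refine ⟨fun g => s (ckGen ω g), fun g => hs _, { R with
      JM_ab_ab := fun a b hab => by simpa using R.JM_ab_ab a b hab
      BB := fun k l hkl => by simpa using R.BB k l hkl
      BI := fun k => by simpa using R.BI k }⟩
  · rintro ⟨X, hX, R⟩
    -- Putting `0` in place of `Ξ` makes `map_lie` applicable to a map out of `u_ω(N+1)`, where the
    -- central element is also `0`.
    have R0 : CKRelations ω X 0 (0 : Fin N → ℝ) 0 0 := { R with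
      JM_ab_ab := fun a b hab => by simpa using R.JM_ab_ab a b hab
      BB := fun k l hkl => by simpa using R.BB k l hkl
      BI := fun k => by simpa using R.BI k }
    have hlie := (ckGen_relations ω).map_lie R0 (by simp) (by simp) (liftSection E X)
      (liftSection_gen X) (map_zero _)
      (fun u => Submodule.span_mono (Set.subset_insert _ _) (span_ckGen u))
    exact ⟨{ liftSection E X with map_lie' := fun {x y} => hlie x y }, proj_liftSection hX⟩

theorem HasCoefficients.isTrivial_iff {E : LieAlgebra.Extension ℝ ℝ (uCK ω)} (hE : IsCentral E)
    (h : HasCoefficients E α β γ) : IsTrivial E ↔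
      (∀ k, ω k = 0 → α k = 0) ∧ (∀ k l, k < l → β k l = 0) ∧ ∀ k, γ k = 0 :=
  isTrivial_iff_hasCoefficients_zero.trans
    ⟨fun h0 => h.unique hE h0, fun ⟨hα, hβ, hγ⟩ => h.change hE hα hβ hγ⟩

end CKExt

/-! ### The directional derivative of the two-index constants. -/

theorem sum_ckBetween_add {N : ℕ} {A : Type*} [AddCommMonoid A] (f : Fin N → A)
    {a b c : Fin (N + 1)} (hab : a ≤ b) (hbc : b ≤ c) :
    ∑ s ∈ ckBetween a c, f s = ∑ s ∈ ckBetween a b, f s + ∑ s ∈ ckBetween b c, f s := by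
  rw [← Finset.sum_union]
  · congr 1
    ext s
    simp only [ckBetween, Finset.mem_union, Finset.mem_filter, Finset.mem_univ, true_and,
      Fin.le_def, Fin.lt_def] at *
    omega
  · rw [Finset.disjoint_left]
    intro s h h'
    simp only [ckBetween, Finset.mem_filter, Finset.mem_univ, true_and] at h h'
    exact absurd h.2 (not_lt.mpr h'.1)

/-- The coefficient `∑ ω_{a,s-1} ω_{s,b} α_s` of `Ξ` in `[J_ab, M_ab]`; it is the derivative
of `ω_ab` in the direction `α`. -/
def ckOmegaDeriv {N : ℕ} (ω α : Fin N → ℝ) (a b : Fin (N + 1)) : ℝ :=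
  ∑ s ∈ ckBetween a b, ckOmega ω a s.castSucc * ckOmega ω s.succ b * α s

theorem ckOmegaDeriv_self {N : ℕ} (ω α : Fin N → ℝ) (a : Fin (N + 1)) :
    ckOmegaDeriv ω α a a = 0 := by
  refine Finset.sum_eq_zero fun s hs => ?_
  simp only [ckBetween, Finset.mem_filter, Finset.mem_univ, true_and] at hs
  exact absurd hs.2 (not_lt.mpr hs.1)

theorem ckOmegaDeriv_castSucc_succ {N : ℕ} (ω α : Fin N → ℝ) (k : Fin N) :
    ckOmegaDeriv ω α k.castSucc k.succ = α k := by
  simp [ckOmegaDeriv, ckBetween_castSucc_succ, ckOmega_self]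

/-- The Leibniz rule for `ω_ac = ω_ab ω_bc`: the sum is split at `b`, and the factor not being
differentiated is completed by the remaining segment. -/
theorem ckOmegaDeriv_mul {N : ℕ} (ω α : Fin N → ℝ) {a b c : Fin (N + 1)} (hab : a ≤ b)
    (hbc : b ≤ c) : ckOmegaDeriv ω α a c =
      ckOmegaDeriv ω α a b * ckOmega ω b c + ckOmega ω a b * ckOmegaDeriv ω α b c := by
  rw [ckOmegaDeriv, sum_ckBetween_add _ hab hbc, ckOmegaDeriv, ckOmegaDeriv, Finset.sum_mul,
    Finset.mul_sum]
  congr 1 <;> refine Finset.sum_congr rfl fun s hs => ?_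
  · have hs' : s.succ ≤ b := by
      simp only [ckBetween, Finset.mem_filter, Finset.mem_univ, true_and] at hs
      exact Fin.castSucc_lt_iff_succ_le.mp hs.2
    rw [← ckOmega_mul ω hs' hbc]
    ring
  · have hs' : b ≤ s.castSucc := by
      simp only [ckBetween, Finset.mem_filter, Finset.mem_univ, true_and] at hs
      exact hs.1
    rw [← ckOmega_mul ω hab hs']
    ring

/-! ### Diagonal elements and their action on the root vectors. -/

theorem mem_uCK_of_mem_explicit {N : ℕ} {ω : Fin N → ℝ}
    {X : Matrix (Fin (N + 1)) (Fin (N + 1)) ℂ} (hX : X ∈ ckExplicit ω) : X ∈ uCK ω := by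
  have h := ckExplicit_le_span ω hX
  rwa [← uCK_toSubmodule] at h

/-- The diagonal element `i ∑ h_a e_aa` of `u_ω(N+1)`. -/
noncomputable def ckTorus {N : ℕ} (ω : Fin N → ℝ) (h : Fin (N + 1) → ℝ) : uCK ω :=
  ⟨Matrix.diagonal fun a => Complex.I * h a, mem_uCK_of_mem_explicit fun a b hab => by
    rcases hab.eq_or_lt with rfl | hlt
    · simp [ckOmega_self]
    · simp [hlt.ne, hlt.ne']⟩

theorem lie_torus_torus {N : ℕ} (ω : Fin N → ℝ) (h h' : Fin (N + 1) → ℝ) :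
    ⁅ckTorus ω h, ckTorus ω h'⁆ = 0 := by
  apply Subtype.ext
  simp [ckTorus, Ring.lie_def, mul_comm]

theorem lie_J_torus {N : ℕ} (ω : Fin N → ℝ) (a b : Fin (N + 1)) (hab : a < b)
    (h : Fin (N + 1) → ℝ) :
    ⁅ckGen ω (.J a b hab), ckTorus ω h⁆ = (h a - h b) • ckGen ω (.M a b hab) := by
  apply Subtype.ext
  change ⁅ckMatrix ω _, Matrix.diagonal _⁆ = (h a - h b) • ckMatrix ω _
  ext x y
  simp only [ckMatrix, Ring.lie_def, Matrix.sub_apply, Matrix.mul_diagonal, Matrix.diagonal_mul,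
    Matrix.smul_apply, Matrix.add_apply, Matrix.neg_apply, Matrix.single_apply]
  have := hab.ne
  split_ifs <;> simp_all <;> ring

theorem lie_M_torus {N : ℕ} (ω : Fin N → ℝ) (a b : Fin (N + 1)) (hab : a < b)
    (h : Fin (N + 1) → ℝ) :
    ⁅ckGen ω (.M a b hab), ckTorus ω h⁆ = -((h a - h b) • ckGen ω (.J a b hab)) := by
  apply Subtype.ext
  change ⁅ckMatrix ω _, Matrix.diagonal _⁆ = -((h a - h b) • ckMatrix ω _)
  ext x y
  simp only [ckMatrix, Ring.lie_def, Matrix.sub_apply, Matrix.mul_diagonal, Matrix.diagonal_mul,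
    Matrix.smul_apply, Matrix.add_apply, Matrix.neg_apply, Matrix.single_apply]
  have := hab.ne
  split_ifs <;> simp_all <;> ring_nf <;> simp [Complex.I_sq]

theorem ckGen_B_eq_torus {N : ℕ} (ω : Fin N → ℝ) (l : Fin N) : ckGen ω (.B l) =
    ckTorus ω fun c => (if c = l.castSucc then 1 else 0) - if c = l.succ then 1 else 0 := by
  apply Subtype.ext
  ext x y
  simp only [ckGen, ckTorus, ckMatrix, Matrix.smul_apply, Matrix.sub_apply, Matrix.single_apply,
    Matrix.diagonal_apply]
  by_cases hxy : x = y
  · subst hxy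
    simp only [eq_comm (b := x), and_self, if_true]
    split_ifs <;> simp
  · have h1 : ∀ c : Fin (N + 1), ¬(c = x ∧ c = y) := fun c hc => hxy (hc.1.symm.trans hc.2)
    simp [h1, hxy]

theorem ckGen_I_eq_torus {N : ℕ} (ω : Fin N → ℝ) : ckGen ω .I = ckTorus ω fun _ => 1 := by
  apply Subtype.ext
  ext x y
  simp [ckGen, ckTorus, ckMatrix, Matrix.one_apply, Matrix.diagonal_apply]

/-! ### Normal form of an arbitrary central extension. -/

namespace CKExt

variable {N : ℕ} {ω : Fin N → ℝ} {E : LieAlgebra.Extension ℝ ℝ (uCK ω)}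

/-- Lifts of the generators such that the lifts of the diagonal elements rotate the lifts of
`J_ab` and `M_ab` without central terms. -/
structure IsAdapted (X : CKGen N → E.L) : Prop where
  proj_eq : ∀ g, E.proj (X g) = ckGen ω g
  lie_J : ∀ a b hab h y, E.proj y = ckTorus ω h →
    ⁅X (.J a b hab), y⁆ = (h a - h b) • X (.M a b hab)
  lie_M : ∀ a b hab h y, E.proj y = ckTorus ω h →
    ⁅X (.M a b hab), y⁆ = -((h a - h b) • X (.J a b hab))

/-- Let `t` lift a diagonal element of weight `1` on the pair. In `[[M, t], y]` the term with `[t,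
y]` drops out by centrality, leaving `-[t, [M, y]]`, where `[M, y]` matters only through its
projection, a multiple of `J`. Hence the brackets with `t` are themselves rotated exactly. -/
theorem exists_isAdapted (hE : IsCentral E) : ∃ X : CKGen N → E.L, IsAdapted X := by
  choose σ hσ using E.proj_surjective
  -- `t a` lifts `i e_aa`, which has weight `1` on every pair `(a, b)` with `a < b`.
  let t : Fin (N + 1) → E.L := fun a => σ (ckTorus ω (Pi.single a 1))
  have ht : ∀ a, E.proj (t a) = ckTorus ω (Pi.single a 1) := fun a => hσ _
  -- Diagonal matrices commute, so `[t a, y]` is a multiple of `Ξ`, hence central.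
  have hcomm : ∀ a h y, E.proj y = ckTorus ω h → ∀ x : E.L, ⁅x, ⁅t a, y⁆⁆ = 0 := by
    intro a h y hy x
    rw [← lie_skew, hE.lie_eq_zero, neg_zero]
    rw [LieHom.map_lie, ht, hy, lie_torus_torus]
  have hJ1 : ∀ a b (hab : a < b), E.proj ⁅σ (ckGen ω (.J a b hab)), t a⁆ = ckGen ω (.M a b hab) := by
    intro a b hab
    rw [LieHom.map_lie, hσ, ht, lie_J_torus]
    simp [hab.ne']
  have hM1 : ∀ a b (hab : a < b), E.proj (-⁅σ (ckGen ω (.M a b hab)), t a⁆) =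
      ckGen ω (.J a b hab) := by
    intro a b hab
    rw [map_neg, LieHom.map_lie, hσ, ht, lie_M_torus]
    simp [hab.ne']
  refine ⟨fun g => match g with
    | .J a b hab => -⁅σ (ckGen ω (.M a b hab)), t a⁆
    | .M a b hab => ⁅σ (ckGen ω (.J a b hab)), t a⁆
    | .B l => σ (ckGen ω (.B l))
    | .I => σ (ckGen ω .I), ?_, ?_, ?_⟩
  · rintro (⟨a, b, hab⟩ | ⟨a, b, hab⟩ | l | _)
    · exact hM1 a b hab
    · exact hJ1 a b hab
    · exact hσ _
    · exact hσ _
  · intro a b hab h y hy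
    dsimp only
    rw [neg_lie, lie_lie, hcomm a h y hy, zero_sub, neg_neg, ← lie_skew,
      hE.lie_congr (x' := -((h a - h b) • σ (ckGen ω (.J a b hab)))) (y' := t a) _ rfl, neg_lie,
      neg_neg, smul_lie]
    rw [LieHom.map_lie, hσ, hy, map_neg, map_smul, hσ, lie_M_torus]
  · intro a b hab h y hy
    dsimp only
    rw [lie_lie, hcomm a h y hy, zero_sub, ← lie_skew (t a), neg_neg,
      hE.lie_congr (x' := (h a - h b) • σ (ckGen ω (.M a b hab))) (y' := t a) _ rfl, smul_lie,
      smul_neg, neg_neg]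
    rw [LieHom.map_lie, hσ, hy, map_smul, hσ, lie_J_torus]

/-- The span of the lifts of the `J_ab` and `M_ab`. -/
noncomputable def rootSpan (X : CKGen N → E.L) : Submodule ℝ E.L :=
  Submodule.span ℝ {w | ∃ a b hab, w = X (.J a b hab) ∨ w = X (.M a b hab)}

@[simp]
theorem J_mem_rootSpan (X : CKGen N → E.L) (a b : Fin (N + 1)) (hab : a < b) :
    X (.J a b hab) ∈ rootSpan X :=
  Submodule.subset_span ⟨a, b, hab, Or.inl rfl⟩

@[simp]
theorem M_mem_rootSpan (X : CKGen N → E.L) (a b : Fin (N + 1)) (hab : a < b) :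
    X (.M a b hab) ∈ rootSpan X :=
  Submodule.subset_span ⟨a, b, hab, Or.inr rfl⟩

/-- Elements of `E` on which lifts of diagonal elements act with weight `h_a - h_b`. -/
def IsRootVector (a b : Fin (N + 1)) (P : E.L) : Prop :=
  a < b ∧ ∀ h y, E.proj y = ckTorus ω h →
    ⁅⁅P, y⁆, y⁆ = -((h a - h b) ^ 2 • P) ∧ (h a = h b → ⁅P, y⁆ = 0)

namespace IsAdapted

variable {X : CKGen N → E.L}

/-- Diagonal elements exchange `J_ab` and `M_ab`, and only the square of the action is scalar on
each. Recording the square lets `lie_eq` treat both kinds uniformly. -/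
theorem root_J (D : IsAdapted X) (a b : Fin (N + 1)) (hab : a < b) :
    IsRootVector a b (X (.J a b hab)) := by
  refine ⟨hab, fun h y hy => ⟨?_, fun h0 => ?_⟩⟩
  · rw [D.lie_J _ _ _ h y hy, smul_lie, D.lie_M _ _ _ h y hy, smul_neg, smul_smul, sq]
  · rw [D.lie_J _ _ _ h y hy, h0, sub_self, zero_smul]

theorem root_M (D : IsAdapted X) (a b : Fin (N + 1)) (hab : a < b) :
    IsRootVector a b (X (.M a b hab)) := by
  refine ⟨hab, fun h y hy => ⟨?_, fun h0 => ?_⟩⟩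
  · rw [D.lie_M _ _ _ h y hy, neg_lie, smul_lie, D.lie_J _ _ _ h y hy, smul_smul, sq]
  · rw [D.lie_M _ _ _ h y hy, h0, sub_self, zero_smul, neg_zero]

theorem lie_mem_rootSpan (D : IsAdapted X) {w : E.L} (hw : w ∈ rootSpan X)
    {h : Fin (N + 1) → ℝ} {y : E.L} (hy : E.proj y = ckTorus ω h) : ⁅w, y⁆ ∈ rootSpan X := by
  induction hw using Submodule.span_induction with
  | mem w hw =>
    obtain ⟨a, b, hab, rfl | rfl⟩ := hw
    · rw [D.lie_J _ _ _ h y hy]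
      exact Submodule.smul_mem _ _ (M_mem_rootSpan X a b hab)
    · rw [D.lie_M _ _ _ h y hy]
      exact neg_mem (Submodule.smul_mem _ _ (J_mem_rootSpan X a b hab))
  | zero => simp
  | add x z _ _ hx hz => rw [add_lie]; exact add_mem hx hz
  | smul r x _ hx => rw [smul_lie]; exact Submodule.smul_mem _ _ hx

/-- The projection is injective on the root span, because the section through the lifts inverts it
there; in particular the span contains no nonzero multiple of `Ξ`. -/
theorem eq_of_proj_eq (D : IsAdapted X) {w w' : E.L} (hw : w ∈ rootSpan X)
    (hw' : w' ∈ rootSpan X) (h : E.proj w = E.proj w') : w = w' := by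
  have key : ∀ w ∈ rootSpan X, liftSection E X (E.proj w) = w := by
    intro w hw
    induction hw using Submodule.span_induction with
    | mem w hw => obtain ⟨a, b, hab, rfl | rfl⟩ := hw <;> rw [D.proj_eq, liftSection_gen]
    | zero => simp
    | add x z _ _ hx hz => rw [map_add, map_add, hx, hz]
    | smul r x _ hx => rw [map_smul, map_smul, hx]
  rw [← key w hw, h, key w' hw']

/-- Brackets of root vectors of different weights have no central terms. -/
theorem lie_eq (D : IsAdapted X) (hE : IsCentral E) {a b c d : Fin (N + 1)} {P Q w : E.L}
    (hP : IsRootVector a b P) (hQ : IsRootVector c d Q)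
    (hne : ¬(a = c ∧ b = d)) (hw : w ∈ rootSpan X) (hproj : E.proj ⁅P, Q⁆ = E.proj w) :
    ⁅P, Q⁆ = w := by
  obtain ⟨hab, hP⟩ := hP
  obtain ⟨hcd, hQ⟩ := hQ
  -- A diagonal element commuting with `P` and squaring to `-1` on `Q`. As the pairs are ordered and
  -- distinct, `c` or `d` lies outside `{a, b}`, and the indicator of that index serves.
  obtain ⟨h, h0, h1⟩ : ∃ h : Fin (N + 1) → ℝ, h a = h b ∧ (h c - h d) ^ 2 = 1 := by
    by_cases hc : c = a ∨ c = b
    · have hd : d ≠ a ∧ d ≠ b := by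
        rcases hc with rfl | rfl
        · exact ⟨hcd.ne', fun h => hne ⟨rfl, h.symm⟩⟩
        · exact ⟨(hab.trans hcd).ne', hcd.ne'⟩
      exact ⟨Pi.single d 1, by simp [hd.1.symm, hd.2.symm], by simp [hcd.ne]⟩
    · push Not at hc
      exact ⟨Pi.single c 1, by simp [hc.1.symm, hc.2.symm], by simp [hcd.ne']⟩
  obtain ⟨y, hy⟩ := E.proj_surjective (ckTorus ω h)
  have hPy := (hP h y hy).2 h0
  have hQy := (hQ h y hy).1
  rw [h1, one_smul] at hQy
  have hz : ⁅⁅⁅P, Q⁆, y⁆, y⁆ = -⁅P, Q⁆ := by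
    have : ∀ Z : E.L, ⁅⁅P, Z⁆, y⁆ = ⁅P, ⁅Z, y⁆⁆ := fun Z => by
      rw [lie_lie, hPy, lie_zero, sub_zero]
    rw [this, this, hQy, lie_neg]
  -- `[P, Q]` is minus its double bracket with `y`, which is unchanged when `[P, Q]` is replaced by
  -- `w`, an element with the same projection. The root span is stable under such brackets.
  have hmem : ⁅P, Q⁆ ∈ rootSpan X := by
    rw [← neg_neg ⁅P, Q⁆, ← hz, hE.lie_congr (x := ⁅P, Q⁆) (x' := w) hproj rfl] 
    exact neg_mem (D.lie_mem_rootSpan (D.lie_mem_rootSpan hw hy) hy)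
  exact D.eq_of_proj_eq hmem hw hproj

/-- Induction on `b`, writing `J_ab` as minus the bracket of `J_{a,b-1}` and `J_{b-1,b}`. Jacobi
gives `ω_b [J_{a,b-1}, M_{a,b-1}] + ω_{a,b-1} [J_{b-1,b}, M_{b-1,b}]`, the recursion satisfied by
`ckOmegaDeriv`. -/
theorem lie_J_M (D : IsAdapted X) (hE : IsCentral E) {α : Fin N → ℝ}
    (hα : ∀ k : Fin N, ⁅X (.J k.castSucc k.succ k.castSucc_lt_succ),
      X (.M k.castSucc k.succ k.castSucc_lt_succ)⁆ = (-2 * ω k) • X (.B k) + α k • Xi E)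
    (a b : Fin (N + 1)) (hab : a < b) : ⁅X (.J a b hab), X (.M a b hab)⁆ =
      (-2 * ckOmega ω a b) • ∑ s ∈ ckBetween a b, X (.B s) + ckOmegaDeriv ω α a b • Xi E := by
  induction b using Fin.induction with
  | zero => exact absurd hab (Fin.not_lt_zero a)
  | succ i ih =>
    rcases (Fin.le_castSucc_iff.mpr hab).eq_or_lt with rfl | hlt
    · rw [hα, ckOmega_castSucc_succ, ckOmegaDeriv_castSucc_succ, ckBetween_castSucc_succ,
        Finset.sum_singleton]
    · have hi := i.castSucc_lt_succ
      have e1 : ⁅X (.J a i.castSucc hlt), X (.J i.castSucc i.succ hi)⁆ = -X (.J a i.succ hab) :=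
        D.lie_eq hE (D.root_J ..) (D.root_J ..) (fun h => hlt.ne h.1)
          (by simp) (by simpa [D.proj_eq] using (ckGen_relations ω).JJ_ab_bc _ _ _ hlt hi)
      have e2 : ⁅X (.J a i.castSucc hlt), X (.M a i.succ hab)⁆ =
          ckOmega ω a i.castSucc • X (.M i.castSucc i.succ hi) :=
        D.lie_eq hE (D.root_J ..) (D.root_M ..) (fun h => hi.ne h.2)
          (Submodule.smul_mem _ _ (by simp))
          (by simpa [D.proj_eq] using (ckGen_relations ω).JM_ab_ac _ _ _ hlt hi)
      have e3 : ⁅X (.J i.castSucc i.succ hi), X (.M a i.succ hab)⁆ =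
          -(ckOmega ω i.castSucc i.succ • X (.M a i.castSucc hlt)) :=
        D.lie_eq hE (D.root_J ..) (D.root_M ..) (fun h => hlt.ne' h.1)
          (neg_mem (Submodule.smul_mem _ _ (by simp))) (by
            have := (ckGen_relations ω).MJ_ac_bc _ _ _ hlt hi
            rw [← lie_skew, map_neg, LieHom.map_lie, D.proj_eq, D.proj_eq, this]
            simp [D.proj_eq])
      have e4 : X (.J a i.succ hab) =
          -⁅X (.J a i.castSucc hlt), X (.J i.castSucc i.succ hi)⁆ := by rw [e1, neg_neg]
      rw [e4, neg_lie, lie_lie, e2, e3, lie_neg, lie_smul, lie_smul, ih hlt, hα,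
        ← ckOmega_mul ω hlt.le hi.le, ckOmegaDeriv_mul ω α hlt.le hi.le,
        sum_ckBetween_add _ hlt.le hi.le, ckBetween_castSucc_succ, Finset.sum_singleton,
        ckOmegaDeriv_castSucc_succ, ckOmega_castSucc_succ]
      module

/-- `α_k` is defined by the neighbouring pair `J_{k-1,k}`, `M_{k-1,k}`; `β` and `γ` exist because
diagonal elements commute below. All other relations hold without central term by `lie_eq` and the
adapted action. -/
theorem hasCoefficients (D : IsAdapted X) (hE : IsCentral E) :
    ∃ α β γ, HasCoefficients E α β γ := by
  have hα : ∀ k : Fin N, ∃ t : ℝ, ⁅X (.J k.castSucc k.succ k.castSucc_lt_succ),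
      X (.M k.castSucc k.succ k.castSucc_lt_succ)⁆ = (-2 * ω k) • X (.B k) + t • Xi E := by
    intro k
    refine exists_eq_add_smul_Xi E ?_
    simpa [D.proj_eq] using (ckGen_relations ω).lie_J_M_succ k
  choose α hα using hα
  have hβ : ∀ k l : Fin N, ∃ t : ℝ, ⁅X (.B k), X (.B l)⁆ = t • Xi E := by
    intro k l
    refine exists_eq_smul_Xi E ?_
    rw [LieHom.map_lie, D.proj_eq, D.proj_eq, ckGen_B_eq_torus, ckGen_B_eq_torus, lie_torus_torus]
  choose β hβ using hβ
  have hγ : ∀ k : Fin N, ∃ t : ℝ, ⁅X (.B k), X .I⁆ = t • Xi E := by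
    intro k
    refine exists_eq_smul_Xi E ?_
    rw [LieHom.map_lie, D.proj_eq, D.proj_eq, ckGen_B_eq_torus, ckGen_I_eq_torus, lie_torus_torus]
  choose γ hγ using hγ
  refine ⟨α, β, γ, X, D.proj_eq, {
    JJ_ab_ac := fun a b c hab hbc => D.lie_eq hE (D.root_J ..) (D.root_J ..) (fun h => hbc.ne h.2)
      (by simp [Submodule.smul_mem]) (by simpa [D.proj_eq] using (ckGen_relations ω).JJ_ab_ac a b c hab hbc)
    JJ_ab_bc := fun a b c hab hbc => D.lie_eq hE (D.root_J ..) (D.root_J ..) (fun h => hab.ne h.1)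
      (by simp) (by simpa [D.proj_eq] using (ckGen_relations ω).JJ_ab_bc a b c hab hbc)
    JJ_ac_bc := fun a b c hab hbc => D.lie_eq hE (D.root_J ..) (D.root_J ..) (fun h => hab.ne h.1)
      (by simp [Submodule.smul_mem]) (by simpa [D.proj_eq] using (ckGen_relations ω).JJ_ac_bc a b c hab hbc)
    MM_ab_ac := fun a b c hab hbc => D.lie_eq hE (D.root_M ..) (D.root_M ..) (fun h => hbc.ne h.2)
      (by simp [Submodule.smul_mem]) (by simpa [D.proj_eq] using (ckGen_relations ω).MM_ab_ac a b c hab hbc)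
    MM_ab_bc := fun a b c hab hbc => D.lie_eq hE (D.root_M ..) (D.root_M ..) (fun h => hab.ne h.1)
      (by simp) (by simpa [D.proj_eq] using (ckGen_relations ω).MM_ab_bc a b c hab hbc)
    MM_ac_bc := fun a b c hab hbc => D.lie_eq hE (D.root_M ..) (D.root_M ..) (fun h => hab.ne h.1)
      (by simp [Submodule.smul_mem]) (by simpa [D.proj_eq] using (ckGen_relations ω).MM_ac_bc a b c hab hbc)
    JM_ab_ac := fun a b c hab hbc => D.lie_eq hE (D.root_J ..) (D.root_M ..) (fun h => hbc.ne h.2)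
      (by simp [Submodule.smul_mem]) (by simpa [D.proj_eq] using (ckGen_relations ω).JM_ab_ac a b c hab hbc)
    JM_ab_bc := fun a b c hab hbc => D.lie_eq hE (D.root_J ..) (D.root_M ..) (fun h => hab.ne h.1)
      (by simp) (by simpa [D.proj_eq] using (ckGen_relations ω).JM_ab_bc a b c hab hbc)
    JM_ac_bc := fun a b c hab hbc => D.lie_eq hE (D.root_J ..) (D.root_M ..) (fun h => hab.ne h.1)
      (by simp [Submodule.smul_mem]) (by simpa [D.proj_eq] using (ckGen_relations ω).JM_ac_bc a b c hab hbc)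
    MJ_ab_ac := fun a b c hab hbc => D.lie_eq hE (D.root_M ..) (D.root_J ..) (fun h => hbc.ne h.2)
      (by simp [Submodule.smul_mem]) (by simpa [D.proj_eq] using (ckGen_relations ω).MJ_ab_ac a b c hab hbc)
    MJ_ab_bc := fun a b c hab hbc => D.lie_eq hE (D.root_M ..) (D.root_J ..) (fun h => hab.ne h.1)
      (by simp) (by simpa [D.proj_eq] using (ckGen_relations ω).MJ_ab_bc a b c hab hbc)
    MJ_ac_bc := fun a b c hab hbc => D.lie_eq hE (D.root_M ..) (D.root_J ..) (fun h => hab.ne h.1)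
      (by simp [Submodule.smul_mem]) (by simpa [D.proj_eq] using (ckGen_relations ω).MJ_ac_bc a b c hab hbc)
    JJ_disjoint := fun a b d e hab hde h1 h2 h3 h4 => D.lie_eq hE (D.root_J ..)
      (D.root_J ..) (fun h => h1 h.1) (zero_mem _)
      (by simpa [D.proj_eq] using (ckGen_relations ω).JJ_disjoint a b d e hab hde h1 h2 h3 h4)
    MM_disjoint := fun a b d e hab hde h1 h2 h3 h4 => D.lie_eq hE (D.root_M ..)
      (D.root_M ..) (fun h => h1 h.1) (zero_mem _)
      (by simpa [D.proj_eq] using (ckGen_relations ω).MM_disjoint a b d e hab hde h1 h2 h3 h4)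
    JM_disjoint := fun a b d e hab hde h1 h2 h3 h4 => D.lie_eq hE (D.root_J ..)
      (D.root_M ..) (fun h => h1 h.1) (zero_mem _)
      (by simpa [D.proj_eq] using (ckGen_relations ω).JM_disjoint a b d e hab hde h1 h2 h3 h4)
    JB := fun a b hab l => by
      rw [D.lie_J a b hab _ _ ((D.proj_eq _).trans (ckGen_B_eq_torus ω l)), ckDelta]
      congr 1
      ring
    MB := fun a b hab l => by
      rw [D.lie_M a b hab _ _ ((D.proj_eq _).trans (ckGen_B_eq_torus ω l)), ckDelta]
      congr 2
      ring
    JM_ab_ab := D.lie_J_M hE hα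
    BB := fun k l _ => hβ k l
    JI := fun a b hab => by
      rw [D.lie_J a b hab _ _ ((D.proj_eq _).trans (ckGen_I_eq_torus ω)), sub_self, zero_smul]
    MI := fun a b hab => by
      rw [D.lie_M a b hab _ _ ((D.proj_eq _).trans (ckGen_I_eq_torus ω)), sub_self, zero_smul,
        neg_zero]
    BI := hγ }⟩

end IsAdapted

end CKExt

-- The extension attached to a cocycle.

universe w

namespace CKExt

/-- The central extension defined by a 2-cocycle with values in the trivial module `ℝ`. -/
theorem exists_extension_of_cocycle {L : Type w} [LieRing L] [LieAlgebra ℝ L]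
    (c : L →ₗ[ℝ] L →ₗ[ℝ] ℝ) (hc : ∀ x, c x x = 0)
    (hc' : ∀ x y z, c x ⁅y, z⁆ + c y ⁅z, x⁆ + c z ⁅x, y⁆ = 0) :
    ∃ E : LieAlgebra.Extension.{0, 0, w, w} ℝ ℝ L, IsCentral E ∧ ∃ j : L →ₗ[ℝ] E.L,
      (∀ u, E.proj (j u) = u) ∧ ∀ u v, ⁅j u, j v⁆ = j ⁅u, v⁆ + c u v • Xi E := by
  -- The kernel `ℝ` is given the trivial action of `L`, as centrality requires.
  let _ : LieRingModule L ℝ := inferInstanceAs (LieRingModule L (TrivialLieModule ℝ L ℝ))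
  have : LieModule ℝ L ℝ := inferInstanceAs (LieModule ℝ L (TrivialLieModule ℝ L ℝ))
  have : LieModule.IsTrivial L ℝ :=
    inferInstanceAs (LieModule.IsTrivial L (TrivialLieModule ℝ L ℝ))
  have : IsLieAbelian ℝ := ⟨fun x y => by rw [Ring.lie_def, mul_comm, sub_self]⟩
  let c₂ : LieModule.Cohomology.twoCochain ℝ L ℝ := ⟨c, hc⟩
  have hskew : ∀ x y, c x y = -c y x := fun x y =>
    (LieModule.Cohomology.twoCochain_skew c₂ y x).symm
  have hcoc : c₂ ∈ LieModule.Cohomology.twoCocycle ℝ L ℝ := by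
    rw [LieModule.Cohomology.mem_twoCocycle_iff_of_trivial]
    intro x y z
    change c x ⁅y, z⁆ = c ⁅x, y⁆ z + c y ⁅x, z⁆
    have h := hc' x y z
    rw [← lie_skew z x, map_neg] at h
    rw [hskew ⁅x, y⁆ z]
    linarith
  let C : LieModule.Cohomology.twoCocycle ℝ L ℝ := ⟨c₂, hcoc⟩
  let E : LieAlgebra.Extension ℝ ℝ L := LieAlgebra.Extension.ofTwoCocycle C
  let p : L × ℝ → E.L := fun u => LieAlgebra.ofProd C u
  -- The model is `L × ℝ` with the bracket twisted by `c`; the two action terms vanish because the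
  -- module is trivial.
  have hbr : ∀ u v : L × ℝ, ⁅p u, p v⁆ = p (⁅u.1, v.1⁆, c u.1 v.1 + ⁅u.1, v.2⁆ - ⁅v.1, u.2⁆) :=
    fun u v => rfl
  have hadd : ∀ u v : L × ℝ, p (u + v) = p u + p v := fun u v => rfl
  have hsmul : ∀ (r : ℝ) (u : L × ℝ), p (r • u) = r • p u := fun r u => rfl
  have hXi : Xi E = p (0, 1) := rfl
  have htriv : ∀ (u : L) (t : ℝ), ⁅u, t⁆ = (0 : ℝ) := fun u t => trivial_lie_zero L ℝ u t
  refine ⟨E, fun x => ?_,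
    { toFun := fun u => p (u, 0)
      map_add' := fun u v => by rw [← hadd, Prod.mk_add_mk, add_zero]
      map_smul' := fun r u => by rw [RingHom.id_apply, ← hsmul, Prod.smul_mk, smul_zero] },
    fun u => rfl, fun u v => ?_⟩
  · obtain ⟨u, rfl⟩ : ∃ u, p u = x := ⟨(LieAlgebra.ofProd C).symm x, rfl⟩
    rw [hXi, hbr]
    simp only [htriv, zero_lie, map_zero, LinearMap.zero_apply, add_zero, sub_zero]
    rfl
  · change ⁅p (u, 0), p (v, 0)⁆ = p (⁅u, v⁆, 0) + c u v • Xi E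
    rw [hbr, hXi, ← hsmul, ← hadd]
    simp [htriv]

end CKExt

/-! ### First-order deformation of `ω`, and functionals vanishing on commutators. -/

section Cocycle

variable {N : ℕ}

/-- `X + ε X'` satisfies to first order in `ε` the equations of `u_{ω + ε α}(N+1)`. -/
def IsCKDeformation (ω α : Fin N → ℝ) (X X' : Matrix (Fin (N + 1)) (Fin (N + 1)) ℂ) : Prop :=
  X ∈ ckExplicit ω ∧ ∀ a b, a ≤ b →
    X' a b = -(ckOmegaDeriv ω α a b * star (X b a) + ckOmega ω a b * star (X' b a))

/-- The coefficient of `ε` in `ck_entry_mul` for the constants `ω + ε α`; the position of `c`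
relative to `a` and `b` decides which Leibniz rule is used. -/
theorem IsCKDeformation.entry_mul {ω α : Fin N → ℝ}
    {X X' Y Y' : Matrix (Fin (N + 1)) (Fin (N + 1)) ℂ} (hX : IsCKDeformation ω α X X')
    (hY : IsCKDeformation ω α Y Y') {a b : Fin (N + 1)} (hab : a ≤ b) (c : Fin (N + 1)) :
    X' a c * Y c b + X a c * Y' c b = ckOmegaDeriv ω α a b * star (Y b c * X c a) +
      ckOmega ω a b * star (Y' b c * X c a + Y b c * X' c a) := by
  simp only [star_add, StarMul.star_mul]
  rcases le_total a c with hac | hca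
  · rcases le_total c b with hcb | hbc
    · rw [hX.1 a c hac, hY.1 c b hcb, hX.2 a c hac, hY.2 c b hcb, ← ckOmega_mul ω hac hcb,
        ckOmegaDeriv_mul ω α hac hcb]
      push_cast
      ring
    · rw [hX.1 a c hac, hY.1 b c hbc, hX.2 a c hac, hY.2 b c hbc, ← ckOmega_mul ω hab hbc,
        ckOmegaDeriv_mul ω α hab hbc]
      simp
      ring
  · rw [hX.1 c a hca, hY.1 c b (hca.trans hab), hX.2 c a hca, hY.2 c b (hca.trans hab),
      ← ckOmega_mul ω hca hab, ckOmegaDeriv_mul ω α hca hab]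
    simp
    ring

/-- The family `u_{ω + ε α}` is closed under brackets, here modulo `ε²`. -/
theorem IsCKDeformation.lie {ω α : Fin N → ℝ}
    {X X' Y Y' : Matrix (Fin (N + 1)) (Fin (N + 1)) ℂ} (hX : IsCKDeformation ω α X X')
    (hY : IsCKDeformation ω α Y Y') : IsCKDeformation ω α ⁅X, Y⁆ (⁅X', Y⁆ + ⁅X, Y'⁆) := by
  refine ⟨(ckExplicit ω).lie_mem hX.1 hY.1, fun a b hab => ?_⟩
  have h1 : (⁅X', Y⁆ + ⁅X, Y'⁆) a b = ∑ c, (X' a c * Y c b + X a c * Y' c b) -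
      ∑ c, (Y' a c * X c b + Y a c * X' c b) := by
    simp only [Ring.lie_def, Matrix.add_apply, Matrix.sub_apply, Matrix.mul_apply,
      Finset.sum_add_distrib]
    ring
  rw [h1, Finset.sum_congr rfl fun c _ => hX.entry_mul hY hab c,
    Finset.sum_congr rfl fun c _ => hY.entry_mul hX hab c]
  simp only [Ring.lie_def, Matrix.add_apply, Matrix.sub_apply, Matrix.mul_apply, star_sub,
    star_add, star_sum, Finset.sum_add_distrib, ← Finset.mul_sum]
  ring

/-- The trace form of `u_{ω + ε α}(N+1)` is real to first order in `ε`. -/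
theorem IsCKDeformation.trace_im {ω α : Fin N → ℝ}
    {X X' Y Y' : Matrix (Fin (N + 1)) (Fin (N + 1)) ℂ} (hX : IsCKDeformation ω α X X')
    (hY : IsCKDeformation ω α Y Y') : (Matrix.trace (X' * Y + X * Y')).im = 0 := by
  -- In `X_ab Y_ba` moving the constant `ω_ab` from one factor to the other yields the conjugate of
  -- `X_ba Y_ab`; this is the `ε`-term of that identity. Thus transposed terms of the trace are
  -- conjugate.
  have key : ∀ a b, a ≤ b →
      X' a b * Y b a + X a b * Y' b a = star (X' b a * Y a b + X b a * Y' a b) := by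
    intro a b hab
    rw [hX.1 a b hab, hX.2 a b hab, hY.1 a b hab, hY.2 a b hab]
    simp
    ring
  have key' : ∀ a b, X' a b * Y b a + X a b * Y' b a = star (X' b a * Y a b + X b a * Y' a b) := by
    intro a b
    rcases le_total a b with h | h
    · exact key a b h
    · rw [key b a h, star_star]
  have htr : Matrix.trace (X' * Y + X * Y') = ∑ a, ∑ b, (X' a b * Y b a + X a b * Y' b a) := by
    simp [Matrix.trace, Matrix.mul_apply, Finset.sum_add_distrib]
  rw [← Complex.conj_eq_iff_im, starRingEnd_apply, htr, star_sum, Finset.sum_comm]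
  refine Finset.sum_congr rfl fun b _ => ?_
  rw [star_sum]
  exact Finset.sum_congr rfl fun a _ => (key' a b).symm

/-- The strictly upper triangular matrix with entries `-(dω_ab/dε) conj(X_ba)`. -/
noncomputable def ckUpperDeriv (ω α : Fin N → ℝ) (X : Matrix (Fin (N + 1)) (Fin (N + 1)) ℂ) :
    Matrix (Fin (N + 1)) (Fin (N + 1)) ℂ :=
  Matrix.of fun a b => if a < b then -(ckOmegaDeriv ω α a b * star (X b a)) else 0

theorem isCKDeformation_upperDeriv {ω : Fin N → ℝ} (α : Fin N → ℝ)
    {X : Matrix (Fin (N + 1)) (Fin (N + 1)) ℂ} (hX : X ∈ ckExplicit ω) :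
    IsCKDeformation ω α X (ckUpperDeriv ω α X) := by
  refine ⟨hX, fun a b hab => ?_⟩
  rcases hab.eq_or_lt with rfl | h
  · simp [ckUpperDeriv, ckOmegaDeriv_self]
  · simp [ckUpperDeriv, h, h.not_gt]

/-- Reality of the trace form is applied to `X` and `[Y, Z]`, the latter deformed by `[Y', Z] + [Y,
Z']`. Cyclicity moves the primed matrix to the front of each term. -/
theorem trace_upperDeriv_cyclic {ω : Fin N → ℝ} (α : Fin N → ℝ)
    {X Y Z : Matrix (Fin (N + 1)) (Fin (N + 1)) ℂ} (hX : X ∈ ckExplicit ω)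
    (hY : Y ∈ ckExplicit ω) (hZ : Z ∈ ckExplicit ω) :
    (Matrix.trace (ckUpperDeriv ω α X * ⁅Y, Z⁆)).im +
      (Matrix.trace (ckUpperDeriv ω α Y * ⁅Z, X⁆)).im +
      (Matrix.trace (ckUpperDeriv ω α Z * ⁅X, Y⁆)).im = 0 := by
  have h := (isCKDeformation_upperDeriv α hX).trace_im
    ((isCKDeformation_upperDeriv α hY).lie (isCKDeformation_upperDeriv α hZ))
  rw [← h, ← Complex.add_im, ← Complex.add_im]
  congr 1
  simp only [Ring.lie_def, mul_add, mul_sub, Matrix.trace_add, Matrix.trace_sub]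
  rw [Matrix.trace_mul_cycle' X (ckUpperDeriv ω α Y) Z,
    Matrix.trace_mul_cycle' X Z (ckUpperDeriv ω α Y),
    Matrix.trace_mul_cycle' X Y (ckUpperDeriv ω α Z),
    Matrix.trace_mul_cycle' X (ckUpperDeriv ω α Z) Y,
    Matrix.trace_mul_cycle' Z X (ckUpperDeriv ω α Y),
    Matrix.trace_mul_cycle' Y X (ckUpperDeriv ω α Z)]
  ring

theorem ckCoord_I_lie (X Y : Matrix (Fin (N + 1)) (Fin (N + 1)) ℂ) :
    ckCoord .I ⁅X, Y⁆ = 0 := by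
  have h : (Matrix.trace ⁅X, Y⁆).im = 0 := by
    rw [Ring.lie_def, Matrix.trace_sub, Matrix.trace_mul_comm, sub_self, Complex.zero_im]
  rw [Matrix.trace, Complex.im_sum] at h
  simp only [Matrix.diag_apply] at h
  simp [ckCoord, LinearMap.sum_apply, h]

/-- For `ω k = 0` the matrices are block lower triangular, with the cut between `k.castSucc` and
`k.succ`. -/
theorem ckExplicit_apply_eq_zero {ω : Fin N → ℝ} {X : Matrix (Fin (N + 1)) (Fin (N + 1)) ℂ}
    (hX : X ∈ ckExplicit ω) {k : Fin N} (hk : ω k = 0) {a b : Fin (N + 1)}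
    (ha : a ≤ k.castSucc) (hb : k.castSucc < b) : X a b = 0 := by
  have h0 : ckOmega ω a b = 0 :=
    Finset.prod_eq_zero (i := k) (by simp [ckBetween, ha, hb]) hk
  rw [hX a b (ha.trans hb.le), h0]
  simp

/-- The `B_k`-coordinate combines the full trace with the trace of the upper left block. By block
triangularity that block of `[X, Y]` is the commutator of the blocks of `X` and `Y`, so both traces
vanish. -/
theorem ckCoord_B_lie {ω : Fin N → ℝ} {X Y : Matrix (Fin (N + 1)) (Fin (N + 1)) ℂ}
    (hX : X ∈ ckExplicit ω) (hY : Y ∈ ckExplicit ω) {k : Fin N} (hk : ω k = 0) :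
    ckCoord (.B k) ⁅X, Y⁆ = 0 := by
  have hI : ∑ a, (⁅X, Y⁆ a a).im = 0 := by
    have h : (Matrix.trace ⁅X, Y⁆).im = 0 := by
      rw [Ring.lie_def, Matrix.trace_sub, Matrix.trace_mul_comm, sub_self, Complex.zero_im]
    rwa [Matrix.trace, Complex.im_sum] at h
  have hprod : ∀ {X Y : Matrix (Fin (N + 1)) (Fin (N + 1)) ℂ}, X ∈ ckExplicit ω →
      ∀ a ∈ Finset.Iic k.castSucc, (X * Y) a a = ∑ b ∈ Finset.Iic k.castSucc, X a b * Y b a := by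
    intro X Y hX a ha
    rw [Matrix.mul_apply]
    refine (Finset.sum_subset (Finset.subset_univ _) fun b _ hb => ?_).symm
    rw [Finset.mem_Iic] at ha
    rw [Finset.mem_Iic, not_le] at hb
    rw [ckExplicit_apply_eq_zero hX hk ha hb, zero_mul]
  have hB : ∑ a ∈ Finset.Iic k.castSucc, ⁅X, Y⁆ a a = 0 := by
    simp only [Ring.lie_def, Matrix.sub_apply, Finset.sum_sub_distrib]
    rw [Finset.sum_congr rfl (hprod hX), Finset.sum_congr rfl (hprod hY), Finset.sum_comm,
      sub_eq_zero]
    exact Finset.sum_congr rfl fun a _ => Finset.sum_congr rfl fun b _ => mul_comm _ _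
  have hB' := congrArg Complex.im hB
  rw [Complex.im_sum, Complex.zero_im] at hB'
  simp [ckCoord, LinearMap.sum_apply, hI, hB']

end Cocycle

/-! ### The cocycle realising given coefficients, and its values on generators. -/

section Cocycle

variable {N : ℕ} {ω : Fin N → ℝ}

/-- The bilinear form on `u_ω(N+1)` with values `∑ ω_{a,s-1} ω_{s,b} α_s` on `(J_ab, M_ab)`,
`β_kl` on `(B_k, B_l)` and `γ_k` on `(B_k, I)`. -/
noncomputable def ckCochain (ω α : Fin N → ℝ) (β : Fin N → Fin N → ℝ) (γ : Fin N → ℝ) :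
    uCK ω →ₗ[ℝ] uCK ω →ₗ[ℝ] ℝ :=
  LinearMap.mk₂ ℝ (fun X Y =>
    (∑ a, ∑ b, if a < b then ckOmegaDeriv ω α a b *
      ((X.1 b a).re * (Y.1 b a).im - (X.1 b a).im * (Y.1 b a).re) else 0) +
    ((∑ k, ∑ l, if k < l then β k l * (ckCoord (.B k) X.1 * ckCoord (.B l) Y.1 -
      ckCoord (.B l) X.1 * ckCoord (.B k) Y.1) else 0) +
    ∑ k, γ k * (ckCoord (.B k) X.1 * ckCoord .I Y.1 - ckCoord .I X.1 * ckCoord (.B k) Y.1)))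
    (fun X X' Y => by
      have hr : ((X + X' : uCK ω) : Matrix (Fin (N + 1)) (Fin (N + 1)) ℂ) = X.1 + X'.1 := rfl
      simp only [hr, Matrix.add_apply, Complex.add_re, Complex.add_im, map_add]
      -- Reduces additivity to that of the `α`-, `β`- and `γ`-sums separately.
      refine (?_ : ∀ {s s' s'' t t' t'' r r' r'' : ℝ}, s = s' + s'' → t = t' + t'' → r = r' + r'' →
        s + (t + r) = s' + (t' + r') + (s'' + (t'' + r''))) ?_ ?_ ?_
      · rintro _ s' s'' _ t' t'' _ r' r'' rfl rfl rfl
        ring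
      · simp only [← Finset.sum_add_distrib]
        refine Finset.sum_congr rfl fun a _ => Finset.sum_congr rfl fun b _ => ?_
        split_ifs <;> ring
      · simp only [← Finset.sum_add_distrib]
        refine Finset.sum_congr rfl fun a _ => Finset.sum_congr rfl fun b _ => ?_
        split_ifs <;> ring
      · rw [← Finset.sum_add_distrib]
        exact Finset.sum_congr rfl fun a _ => by ring)
    (fun r X Y => by
      have hr : ((r • X : uCK ω) : Matrix (Fin (N + 1)) (Fin (N + 1)) ℂ) = r • X.1 := rfl
      simp only [hr, Matrix.smul_apply, Complex.smul_re, Complex.smul_im, map_smul, smul_eq_mul,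
        mul_add, Finset.mul_sum, mul_ite, mul_zero]
      congr 1
      · refine Finset.sum_congr rfl fun a _ => Finset.sum_congr rfl fun b _ => ?_
        split_ifs <;> ring
      · congr 1
        · refine Finset.sum_congr rfl fun a _ => Finset.sum_congr rfl fun b _ => ?_
          split_ifs <;> ring
        · exact Finset.sum_congr rfl fun a _ => by ring)
    (fun X Y Y' => by
      have hr : ((Y + Y' : uCK ω) : Matrix (Fin (N + 1)) (Fin (N + 1)) ℂ) = Y.1 + Y'.1 := rfl
      simp only [hr, Matrix.add_apply, Complex.add_re, Complex.add_im, map_add]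
      refine (?_ : ∀ {s s' s'' t t' t'' r r' r'' : ℝ}, s = s' + s'' → t = t' + t'' → r = r' + r'' →
        s + (t + r) = s' + (t' + r') + (s'' + (t'' + r''))) ?_ ?_ ?_
      · rintro _ s' s'' _ t' t'' _ r' r'' rfl rfl rfl
        ring
      · simp only [← Finset.sum_add_distrib]
        refine Finset.sum_congr rfl fun a _ => Finset.sum_congr rfl fun b _ => ?_
        split_ifs <;> ring
      · simp only [← Finset.sum_add_distrib]
        refine Finset.sum_congr rfl fun a _ => Finset.sum_congr rfl fun b _ => ?_
        split_ifs <;> ring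
      · rw [← Finset.sum_add_distrib]
        exact Finset.sum_congr rfl fun a _ => by ring)
    (fun r X Y => by
      have hr : ((r • Y : uCK ω) : Matrix (Fin (N + 1)) (Fin (N + 1)) ℂ) = r • Y.1 := rfl
      simp only [hr, Matrix.smul_apply, Complex.smul_re, Complex.smul_im, map_smul, smul_eq_mul,
        mul_add, Finset.mul_sum, mul_ite, mul_zero]
      congr 1
      · refine Finset.sum_congr rfl fun a _ => Finset.sum_congr rfl fun b _ => ?_
        split_ifs <;> ring
      · congr 1
        · refine Finset.sum_congr rfl fun a _ => Finset.sum_congr rfl fun b _ => ?_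
          split_ifs <;> ring
        · exact Finset.sum_congr rfl fun a _ => by ring)

theorem ckCochain_apply (α : Fin N → ℝ) (β : Fin N → Fin N → ℝ) (γ : Fin N → ℝ) (X Y : uCK ω) :
    ckCochain ω α β γ X Y =
    (∑ a, ∑ b, if a < b then ckOmegaDeriv ω α a b *
      ((X.1 b a).re * (Y.1 b a).im - (X.1 b a).im * (Y.1 b a).re) else 0) +
    ((∑ k, ∑ l, if k < l then β k l * (ckCoord (.B k) X.1 * ckCoord (.B l) Y.1 -
      ckCoord (.B l) X.1 * ckCoord (.B k) Y.1) else 0) +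
    ∑ k, γ k * (ckCoord (.B k) X.1 * ckCoord .I Y.1 - ckCoord .I X.1 * ckCoord (.B k) Y.1)) :=
  rfl

theorem ckCochain_skew (α : Fin N → ℝ) (β : Fin N → Fin N → ℝ) (γ : Fin N → ℝ) (X Y : uCK ω) :
    ckCochain ω α β γ X Y = -ckCochain ω α β γ Y X := by
  rw [ckCochain_apply, ckCochain_apply, neg_add, neg_add]
  simp only [← Finset.sum_neg_distrib]
  congr 1
  · refine Finset.sum_congr rfl fun a _ => Finset.sum_congr rfl fun b _ => ?_
    split_ifs <;> ring
  · congr 1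
    · refine Finset.sum_congr rfl fun a _ => Finset.sum_congr rfl fun b _ => ?_
      split_ifs <;> ring
    · exact Finset.sum_congr rfl fun a _ => by ring

theorem mem_explicit_of_mem_uCK (X : uCK ω) : X.1 ∈ ckExplicit ω := by
  have h : uCK ω ≤ ckExplicit ω := LieSubalgebra.lieSpan_le.mpr (by
    rintro _ ⟨g, rfl⟩; exact ckMatrix_mem_explicit ω g)
  exact h X.2

/-- Against a commutator the `β`- and `γ`-sums vanish: a nonzero coefficient forces the relevant `ω`
to be zero, and then the coordinates involved kill commutators. The `α`-sum is minus the imaginary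
part of a trace, since `Im (conj x * w)` is the bracketed expression. -/
theorem ckCochain_lie {α : Fin N → ℝ} {β : Fin N → Fin N → ℝ} {γ : Fin N → ℝ}
    (h : CKAdmissible ω β γ) (X Y Z : uCK ω) :
    ckCochain ω α β γ X ⁅Y, Z⁆ = -(Matrix.trace (ckUpperDeriv ω α X.1 * ⁅Y.1, Z.1⁆)).im := by
  have hB : ∀ k, ω k = 0 → ckCoord (.B k) ⁅Y.1, Z.1⁆ = 0 := fun k hk =>
    ckCoord_B_lie (mem_explicit_of_mem_uCK Y) (mem_explicit_of_mem_uCK Z) hk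
  have hβ : ∀ k l, k < l → β k l ≠ 0 → ω k = 0 ∧ ω l = 0 := fun k l hkl h0 =>
    ⟨(mul_eq_zero.mp (h.beta_left k l hkl)).resolve_right h0,
      (mul_eq_zero.mp (h.beta_right k l hkl)).resolve_right h0⟩
  have hγ : ∀ k, γ k ≠ 0 → ω k = 0 := fun k h0 => (mul_eq_zero.mp (h.gamma k)).resolve_right h0
  rw [ckCochain_apply, LieSubalgebra.coe_bracket]
  have h2 : (∑ k, ∑ l, if k < l then β k l * (ckCoord (.B k) X.1 * ckCoord (.B l) ⁅Y.1, Z.1⁆ -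
      ckCoord (.B l) X.1 * ckCoord (.B k) ⁅Y.1, Z.1⁆) else 0) = 0 := by
    refine Finset.sum_eq_zero fun k _ => Finset.sum_eq_zero fun l _ => ?_
    split_ifs with hkl
    · by_cases h0 : β k l = 0
      · rw [h0, zero_mul]
      · rw [hB k (hβ k l hkl h0).1, hB l (hβ k l hkl h0).2]
        ring
    · rfl
  have h3 : (∑ k, γ k * (ckCoord (.B k) X.1 * ckCoord .I ⁅Y.1, Z.1⁆ -
      ckCoord .I X.1 * ckCoord (.B k) ⁅Y.1, Z.1⁆)) = 0 := by
    refine Finset.sum_eq_zero fun k _ => ?_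
    by_cases h0 : γ k = 0
    · rw [h0, zero_mul]
    · rw [hB k (hγ k h0), ckCoord_I_lie]
      ring
  rw [h2, h3, add_zero, add_zero]
  generalize ⁅Y.1, Z.1⁆ = W
  simp only [Matrix.trace, Matrix.diag_apply, Matrix.mul_apply,
    Complex.im_sum, ← Finset.sum_neg_distrib]
  refine Finset.sum_congr rfl fun a _ => Finset.sum_congr rfl fun b _ => ?_
  simp only [ckUpperDeriv, Matrix.of_apply]
  split_ifs
  · simp
    ring
  · simp

theorem ckCochain_cyclic {α : Fin N → ℝ} {β : Fin N → Fin N → ℝ} {γ : Fin N → ℝ}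
    (h : CKAdmissible ω β γ) (X Y Z : uCK ω) :
    ckCochain ω α β γ X ⁅Y, Z⁆ + ckCochain ω α β γ Y ⁅Z, X⁆ + ckCochain ω α β γ Z ⁅X, Y⁆ = 0 := by
  rw [ckCochain_lie h, ckCochain_lie h, ckCochain_lie h]
  have := trace_upperDeriv_cyclic α (mem_explicit_of_mem_uCK X) (mem_explicit_of_mem_uCK Y)
    (mem_explicit_of_mem_uCK Z)
  linarith

/-- The `α`-sum reads matrices only below the diagonal, where the constants `ω` do not appear. -/
theorem ckGen_J_lower {a b : Fin (N + 1)} (h : a < b) {x y : Fin (N + 1)} (hxy : x < y) :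
    (ckGen ω (.J a b h)).1 y x = if a = x ∧ b = y then 1 else 0 := by
  have h1 : ¬(a = y ∧ b = x) := by rintro ⟨rfl, rfl⟩; exact lt_asymm h hxy
  simp [ckGen, ckMatrix, Matrix.single_apply, h1, and_comm]

theorem ckGen_M_lower {a b : Fin (N + 1)} (h : a < b) {x y : Fin (N + 1)} (hxy : x < y) :
    (ckGen ω (.M a b h)).1 y x = if a = x ∧ b = y then Complex.I else 0 := by
  have h1 : ¬(a = y ∧ b = x) := by rintro ⟨rfl, rfl⟩; exact lt_asymm h hxy
  simp [ckGen, ckMatrix, Matrix.single_apply, h1, and_comm]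

theorem ckGen_B_lower (l : Fin N) {x y : Fin (N + 1)} (hxy : x < y) :
    (ckGen ω (.B l)).1 y x = 0 := by
  have h1 : ∀ c : Fin (N + 1), ¬(c = y ∧ c = x) := fun c hc => hxy.ne (hc.2.symm.trans hc.1)
  simp [ckGen, ckMatrix, h1]

theorem ckGen_I_lower {x y : Fin (N + 1)} (hxy : x < y) : (ckGen ω .I).1 y x = 0 := by
  simp [ckGen, ckMatrix, hxy.ne']

variable (α : Fin N → ℝ) (β : Fin N → Fin N → ℝ) (γ : Fin N → ℝ)

/-- For a root vector as first argument only the first summand of the cochain contributes. -/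
theorem ckCochain_eq_sum_of_coord {X Y : uCK ω} (hB : ∀ k, ckCoord (.B k) X.1 = 0)
    (hI : ckCoord .I X.1 = 0) : ckCochain ω α β γ X Y =
      ∑ a, ∑ b, if a < b then ckOmegaDeriv ω α a b *
        ((X.1 b a).re * (Y.1 b a).im - (X.1 b a).im * (Y.1 b a).re) else 0 := by
  simp [ckCochain_apply, hB, hI]

theorem ckCoord_ckGen_of_ne {g h : CKGen N} (hgh : g ≠ h) : ckCoord g (ckGen ω h).1 = 0 := by
  classical
  exact (ckCoord_apply ω g h).trans (if_neg hgh)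

theorem ckCoord_ckGen_self (g : CKGen N) : ckCoord g (ckGen ω g).1 = 1 := by
  classical
  exact (ckCoord_apply ω g g).trans (if_pos rfl)

theorem ckCochain_J_left (a b : Fin (N + 1)) (h : a < b) (Y : uCK ω) :
    ckCochain ω α β γ (ckGen ω (.J a b h)) Y = ckOmegaDeriv ω α a b * (Y.1 b a).im := by
  rw [ckCochain_eq_sum_of_coord α β γ (fun k => ckCoord_ckGen_of_ne (by simp))
    (ckCoord_ckGen_of_ne (by simp)), Finset.sum_eq_single a, Finset.sum_eq_single b]
  · simp [h, ckGen_J_lower]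
  · intro y _ hy
    split_ifs with hlt
    · simp [ckGen_J_lower h hlt, hy.symm]
    · rfl
  · simp
  · intro x _ hx
    refine Finset.sum_eq_zero fun y _ => ?_
    split_ifs with hlt
    · simp [ckGen_J_lower h hlt, hx.symm]
    · rfl
  · simp

theorem ckCochain_M_left (a b : Fin (N + 1)) (h : a < b) (Y : uCK ω) :
    ckCochain ω α β γ (ckGen ω (.M a b h)) Y = -(ckOmegaDeriv ω α a b * (Y.1 b a).re) := by
  rw [ckCochain_eq_sum_of_coord α β γ (fun k => ckCoord_ckGen_of_ne (by simp))
    (ckCoord_ckGen_of_ne (by simp)), Finset.sum_eq_single a, Finset.sum_eq_single b]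
  · simp [h, ckGen_M_lower]
  · intro y _ hy
    split_ifs with hlt
    · simp [ckGen_M_lower h hlt, hy.symm]
    · rfl
  · simp
  · intro x _ hx
    refine Finset.sum_eq_zero fun y _ => ?_
    split_ifs with hlt
    · simp [ckGen_M_lower h hlt, hx.symm]
    · rfl
  · simp

theorem ckCochain_JJ (a b d e : Fin (N + 1)) (hab : a < b) (hde : d < e) :
    ckCochain ω α β γ (ckGen ω (.J a b hab)) (ckGen ω (.J d e hde)) = 0 := by
  rw [ckCochain_J_left, ckGen_J_lower hde hab]
  split_ifs <;> simp

theorem ckCochain_MM (a b d e : Fin (N + 1)) (hab : a < b) (hde : d < e) :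
    ckCochain ω α β γ (ckGen ω (.M a b hab)) (ckGen ω (.M d e hde)) = 0 := by
  rw [ckCochain_M_left, ckGen_M_lower hde hab]
  split_ifs <;> simp

theorem ckCochain_JM_of_ne {a b d e : Fin (N + 1)} (hab : a < b) (hde : d < e)
    (hne : ¬(a = d ∧ b = e)) :
    ckCochain ω α β γ (ckGen ω (.J a b hab)) (ckGen ω (.M d e hde)) = 0 := by
  rw [ckCochain_J_left, ckGen_M_lower hde hab, if_neg fun h => hne ⟨h.1.symm, h.2.symm⟩]
  simp

theorem ckCochain_MJ_of_ne {a b d e : Fin (N + 1)} (hab : a < b) (hde : d < e)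
    (hne : ¬(a = d ∧ b = e)) :
    ckCochain ω α β γ (ckGen ω (.M a b hab)) (ckGen ω (.J d e hde)) = 0 := by
  rw [ckCochain_M_left, ckGen_J_lower hde hab, if_neg fun h => hne ⟨h.1.symm, h.2.symm⟩]
  simp

theorem ckCochain_JM_self (a b : Fin (N + 1)) (hab : a < b) :
    ckCochain ω α β γ (ckGen ω (.J a b hab)) (ckGen ω (.M a b hab)) = ckOmegaDeriv ω α a b := by
  rw [ckCochain_J_left, ckGen_M_lower hab hab]
  simp

theorem ckCochain_B_left (k : Fin N) (Y : uCK ω) :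
    ckCochain ω α β γ (ckGen ω (.B k)) Y =
      (∑ l, if k < l then β k l * ckCoord (.B l) Y.1 else 0) -
      (∑ l, if l < k then β l k * ckCoord (.B l) Y.1 else 0) + γ k * ckCoord .I Y.1 := by
  classical
  have hc : ∀ l, ckCoord (.B l) (ckGen ω (.B k)).1 = if l = k then 1 else 0 := fun l => by
    split_ifs with h
    · rw [h, ckCoord_ckGen_self]
    · exact ckCoord_ckGen_of_ne (by simpa using h)
  have hI : ckCoord .I (ckGen ω (.B k)).1 = 0 := ckCoord_ckGen_of_ne (by simp)
  have h1 : (∑ a, ∑ b, if a < b then ckOmegaDeriv ω α a b *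
      (((ckGen ω (.B k)).1 b a).re * (Y.1 b a).im -
        ((ckGen ω (.B k)).1 b a).im * (Y.1 b a).re) else 0) = 0 := by
    refine Finset.sum_eq_zero fun x _ => Finset.sum_eq_zero fun y _ => ?_
    split_ifs with hlt
    · simp [ckGen_B_lower k hlt]
    · rfl
  -- Splits each term into a part supported on `m = k` and one supported on `l = k`, so that both
  -- double sums collapse. For `m = l = k` the strict inequality makes everything zero.
  have h2 : ∀ m l : Fin N, (if m < l then β m l * ((if m = k then 1 else 0) * ckCoord (.B l) Y.1 -
      (if l = k then 1 else 0) * ckCoord (.B m) Y.1) else 0) =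
      (if m = k then (if k < l then β k l * ckCoord (.B l) Y.1 else 0) else 0) -
      (if l = k then (if m < k then β m k * ckCoord (.B m) Y.1 else 0) else 0) := by
    intro m l
    by_cases hm : m = k
    · subst hm
      by_cases hl : l = m
      · subst hl
        simp
      · simp [hl]
    · by_cases hl : l = k
      · subst hl
        simp only [hm, if_false, if_true, zero_mul, one_mul, zero_sub, mul_neg]
        split_ifs <;> simp
      · simp [hm, hl]
  rw [ckCochain_apply, h1, zero_add]
  simp only [hc, hI, h2, Finset.sum_sub_distrib]
  simp [Finset.sum_ite_eq', Finset.sum_ite_irrel]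

theorem ckCochain_BB {k l : Fin N} (hkl : k < l) :
    ckCochain ω α β γ (ckGen ω (.B k)) (ckGen ω (.B l)) = β k l := by
  classical
  have hc : ∀ m, ckCoord (.B m) (ckGen ω (.B l)).1 = if m = l then 1 else 0 := fun m => by
    split_ifs with h
    · rw [h, ckCoord_ckGen_self]
    · exact ckCoord_ckGen_of_ne (by simpa using h)
  rw [ckCochain_B_left, ckCoord_ckGen_of_ne (g := .I) (by simp)]
  simp only [hc, mul_ite, mul_one, mul_zero, add_zero]
  rw [Finset.sum_eq_single l, Finset.sum_eq_zero]
  · simp [hkl]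
  · intro m _
    split_ifs with h1 h2
    · exact absurd (h2 ▸ h1) hkl.not_gt
    · rfl
    · rfl
  · intro m _ hm
    simp [hm]
  · simp

theorem ckCochain_BI (k : Fin N) :
    ckCochain ω α β γ (ckGen ω (.B k)) (ckGen ω .I) = γ k := by
  rw [ckCochain_B_left, ckCoord_ckGen_self]
  simp [ckCoord_ckGen_of_ne]

end Cocycle

/-! ### Existence of extensions with admissible coefficients. -/

namespace CKExt

theorem exists_hasCoefficients {N : ℕ} {ω : Fin N → ℝ} (α : Fin N → ℝ) (β : Fin N → Fin N → ℝ)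
    (γ : Fin N → ℝ) (h : CKAdmissible ω β γ) :
    ∃ E : LieAlgebra.Extension.{0, 0, 0, 0} ℝ ℝ (uCK ω),
      IsCentral E ∧ HasCoefficients E α β γ := by
  obtain ⟨E, hE, j, hj, hlie⟩ := exists_extension_of_cocycle (ckCochain ω α β γ)
    (fun x => self_eq_neg.mp (ckCochain_skew α β γ x x)) (ckCochain_cyclic h)
  -- Relations of `u_ω(N+1)` lift unchanged wherever the cochain vanishes. Only `[J_ab, M_ab]`,
  -- `[B_k, B_l]` and `[B_k, I]` need its nonzero values.
  have hrel : ∀ {u v w : uCK ω}, ⁅u, v⁆ = w → ckCochain ω α β γ u v = 0 → ⁅j u, j v⁆ = j w := by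
    intro u v w huv hc
    rw [hlie, huv, hc, zero_smul, add_zero]
  refine ⟨E, hE, fun g => j (ckGen ω g), fun g => hj _, {
    JJ_ab_ac := fun a b c hab hbc => by
      simpa using hrel ((ckGen_relations ω).JJ_ab_ac a b c hab hbc) (ckCochain_JJ ..)
    JJ_ab_bc := fun a b c hab hbc => by
      simpa using hrel ((ckGen_relations ω).JJ_ab_bc a b c hab hbc) (ckCochain_JJ ..)
    JJ_ac_bc := fun a b c hab hbc => by
      simpa using hrel ((ckGen_relations ω).JJ_ac_bc a b c hab hbc) (ckCochain_JJ ..)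
    MM_ab_ac := fun a b c hab hbc => by
      simpa using hrel ((ckGen_relations ω).MM_ab_ac a b c hab hbc) (ckCochain_MM ..)
    MM_ab_bc := fun a b c hab hbc => by
      simpa using hrel ((ckGen_relations ω).MM_ab_bc a b c hab hbc) (ckCochain_MM ..)
    MM_ac_bc := fun a b c hab hbc => by
      simpa using hrel ((ckGen_relations ω).MM_ac_bc a b c hab hbc) (ckCochain_MM ..)
    JM_ab_ac := fun a b c hab hbc => by
      simpa using hrel ((ckGen_relations ω).JM_ab_ac a b c hab hbc) (ckCochain_JM_of_ne α β γ _ _ (fun h => hbc.ne h.2))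
    JM_ab_bc := fun a b c hab hbc => by
      simpa using hrel ((ckGen_relations ω).JM_ab_bc a b c hab hbc) (ckCochain_JM_of_ne α β γ _ _ (fun h => hab.ne h.1))
    JM_ac_bc := fun a b c hab hbc => by
      simpa using hrel ((ckGen_relations ω).JM_ac_bc a b c hab hbc) (ckCochain_JM_of_ne α β γ _ _ (fun h => hab.ne h.1))
    MJ_ab_ac := fun a b c hab hbc => by
      simpa using hrel ((ckGen_relations ω).MJ_ab_ac a b c hab hbc) (ckCochain_MJ_of_ne α β γ _ _ (fun h => hbc.ne h.2))
    MJ_ab_bc := fun a b c hab hbc => by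
      simpa using hrel ((ckGen_relations ω).MJ_ab_bc a b c hab hbc) (ckCochain_MJ_of_ne α β γ _ _ (fun h => hab.ne h.1))
    MJ_ac_bc := fun a b c hab hbc => by
      simpa using hrel ((ckGen_relations ω).MJ_ac_bc a b c hab hbc) (ckCochain_MJ_of_ne α β γ _ _ (fun h => hab.ne h.1))
    JJ_disjoint := fun a b d e hab hde h1 h2 h3 h4 => by
      simpa using hrel ((ckGen_relations ω).JJ_disjoint a b d e hab hde h1 h2 h3 h4) (ckCochain_JJ ..)
    MM_disjoint := fun a b d e hab hde h1 h2 h3 h4 => by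
      simpa using hrel ((ckGen_relations ω).MM_disjoint a b d e hab hde h1 h2 h3 h4) (ckCochain_MM ..)
    JM_disjoint := fun a b d e hab hde h1 h2 h3 h4 => by
      simpa using hrel ((ckGen_relations ω).JM_disjoint a b d e hab hde h1 h2 h3 h4) (ckCochain_JM_of_ne α β γ _ _ (fun h => h1 h.1))
    JB := fun a b hab l => by
      simpa using hrel ((ckGen_relations ω).JB a b hab l)
        (by rw [ckCochain_J_left, ckGen_B_lower l hab]; simp)
    MB := fun a b hab l => by
      simpa using hrel ((ckGen_relations ω).MB a b hab l)
        (by rw [ckCochain_M_left, ckGen_B_lower l hab]; simp)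
    JM_ab_ab := fun a b hab => by
      rw [hlie, (ckGen_relations ω).JM_ab_ab a b hab, ckCochain_JM_self]
      simp [ckOmegaDeriv]
    BB := fun k l hkl => by
      rw [hlie, (ckGen_relations ω).BB k l hkl, ckCochain_BB α β γ hkl]
      simp
    JI := fun a b hab => by
      simpa using hrel ((ckGen_relations ω).JI a b hab)
        (by rw [ckCochain_J_left, ckGen_I_lower hab]; simp)
    MI := fun a b hab => by
      simpa using hrel ((ckGen_relations ω).MI a b hab)
        (by rw [ckCochain_M_left, ckGen_I_lower hab]; simp)
    BI := fun k => by
      rw [hlie, (ckGen_relations ω).BI k, ckCochain_BI]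
      simp }⟩

end CKExt

universe u v

theorem theorem4p2 (N : ℕ) (ω : Fin N → ℝ) :
    -- every central extension can be written in the stated form
    (∀ E : LieAlgebra.Extension.{0, 0, 0, u} ℝ ℝ (uCK ω), CKExt.IsCentral E →
      ∃ α β γ, CKExt.HasCoefficients E α β γ) ∧
    -- the coefficients always satisfy `ω_k β_kl = ω_l β_kl = 0` and `ω_k γ_k = 0`
    (∀ E : LieAlgebra.Extension.{0, 0, 0, u} ℝ ℝ (uCK ω), CKExt.IsCentral E →
      ∀ α β γ, CKExt.HasCoefficients E α β γ → CKAdmissible ω β γ) ∧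
    -- all coefficients with these properties occur
    (∀ α β γ, CKAdmissible ω β γ →
      ∃ E : LieAlgebra.Extension.{0, 0, 0, 0} ℝ ℝ (uCK ω),
        CKExt.IsCentral E ∧ CKExt.HasCoefficients E α β γ) ∧
    -- equivalence of extensions in terms of the coefficients
    (∀ (E : LieAlgebra.Extension.{0, 0, 0, u} ℝ ℝ (uCK ω))
        (E' : LieAlgebra.Extension.{0, 0, 0, v} ℝ ℝ (uCK ω)),
      CKExt.IsCentral E → CKExt.IsCentral E' →
      ∀ α β γ α' β' γ', CKExt.HasCoefficients E α β γ → CKExt.HasCoefficients E' α' β' γ' →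
        (CKExt.Equivalent E E' ↔
          (∀ k, ω k = 0 → α k = α' k) ∧ (∀ k l, k < l → β k l = β' k l) ∧ ∀ k, γ k = γ' k)) ∧
    -- triviality: `α_k` matters exactly if `ω_k = 0`, non-zero `β_kl` and `γ_k` always do
    (∀ E : LieAlgebra.Extension.{0, 0, 0, u} ℝ ℝ (uCK ω), CKExt.IsCentral E →
      ∀ α β γ, CKExt.HasCoefficients E α β γ →
        (CKExt.IsTrivial E ↔
          (∀ k, ω k = 0 → α k = 0) ∧ (∀ k l, k < l → β k l = 0) ∧ ∀ k, γ k = 0)) := by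
  refine ⟨fun E hE => ?_, fun E hE α β γ h => ?_, CKExt.exists_hasCoefficients,
    fun E E' hE hE' α β γ α' β' γ' h h' => h.equivalent_iff hE hE' h',
    fun E hE α β γ h => h.isTrivial_iff hE⟩
  · obtain ⟨X, hX⟩ := CKExt.exists_isAdapted hE
    exact hX.hasCoefficients hE
  · obtain ⟨X, _, R⟩ := h
    exact R.admissible hE (CKExt.Xi_ne_zero E)
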